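/- Let $a,x,y$ be real with $0<a<1$, $x+\tfrac12\in(-\tfrac12,\tfrac12)$, $y>0$, and put $z=x+iy$, $q=e^{2\pi i z}$; powers are $q^s:=e^{2\pi i s z}$, and functions of $q$ are regarded as functions of $z$, with $-q=e^{2\pi i(z+1/2)}$. Let $\vartheta_2(v,q)=\sum_{n\in\mathbb Z}q^{(n+1/2)^2}e^{(2n+1)iv}$, $\vartheta_3(v,q)=\sum_{n\in\mathbb Z}q^{n^2}e^{2niv}$, $\vartheta_j(q)=\vartheta_j(0,q)$ and $$m(q)=\frac{\vartheta_2(q)^2}{\vartheta_3(q)^2},\qquad m'(q)=\sqrt{1-m(q)^2},\qquad K=K(q)=K(m(q)),\qquad K'=K'(q)=K(m'(q)),\qquad K(k)=\tfrac{\pi}{2}\,{}_2F_1\!\left(\tfrac12,\tfrac12;1;k^2\right),$$ where $m'(q),K,K'$ have their usual positive values when $z$ lies on the positive imaginary axis (there $0<m(q)<1$) and denote, for every other $z$ in the upper half plane, the (existing and unique) holomorphic continuations of these functions of $z$; there $m(q)$, $K$ and $K'$ do not vanish. Let $\mathrm{cd}$ be the Jacobi elliptic function $$\mathrm{cd}(q,u)=\frac{\vartheta_3(q)}{\vartheta_2(q)}\,\frac{\vartheta_2(v,q)}{\vartheta_3(v,q)},\qquad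 v=\frac{\pi u}{2K},$$ and put $$\mathrm{cd}_1(q,u)=\frac{2\pi}{K\,m(q)}\sum_{n=0}^\infty\frac{(-1)^nq^{n+1/2}\cos\left((2n+3)\frac{\pi}{2K}u\right)}{1-q^{2n+1}},\qquad \mathrm{ss}(q,u)=\frac{2\pi}{K\,m(q)}\sum_{n=0}^\infty\frac{q^{n+1/2}\sin\left((2n+1)\frac{\pi}{2K}u\right)}{1+q^{2n+1}},$$ $$\theta(u)=\theta(q,u)=2\sum_{n=0}^\infty\operatorname{arctanh}(q^{n+u})\quad(u>0),$$ the modular angle, with the principal branch of $\operatorname{arctanh}$ on the unit disc. In $\mathrm{ss}(-q,u)$ all of $q^{n+1/2}$, $m$, $K$ are taken at $z+\tfrac12$. Finally let $\theta_1=-K+(4a-2)xK$, $\theta_2=(4a-2)yK$ and $\theta_0=\theta_1+i\theta_2$. Then $$q^a=i\,q^{1/2}e^{i\pi\theta_0/(2K)},$$ the series for $\theta(u)$ converges for every $u>0$, $\theta$ is differentiable at $a$, the series for $\mathrm{cd}_1(q,\theta_0)$ and $\mathrm{ss}(-q,m'(q)\theta_0)$ converge absolutely, $\theta_0$ is not a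 pole of $\mathrm{cd}(q,\cdot)$, and $$\mathrm{cd}_1(q,\theta_0)=e^{-i\pi\theta_0/K}\,\mathrm{cd}(q,\theta_0)-\frac{\sin(\pi\theta_0/K)}{m(q)K'}\left(\frac{d\theta(u)}{du}\right)_{u=a},$$ $$\mathrm{ss}(-q,m'(q)\theta_0)=\frac{1}{m(q)K'}\left(\frac{d\theta(u)}{du}\right)_{u=a}+i\,\mathrm{cd}(q,\theta_0).$$ -/

import Mathlib

noncomputable section

namespace ModularAngle

open Complex

/-- The open upper half plane, in which the parameter `z` of the nome `q = e(z)` lives. -/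
def upperHalf : Set ℂ := {z | 0 < z.im}

/-- The power `q ^ s` of `q = e(z) = exp (2 π i z)`, i.e. `e(s z)`. -/
def qpow (z s : ℂ) : ℂ := exp (2 * Real.pi * I * z * s)

/-- The theta function `ϑ₂(v, q) = ∑ q ^ ((n + 1/2) ^ 2) e ^ ((2 n + 1) i v)`, `q = e(z)`. -/
def theta2 (z v : ℂ) : ℂ :=
  ∑' n : ℤ, qpow z (((n : ℂ) + 1 / 2) ^ 2) * exp ((2 * (n : ℂ) + 1) * I * v)

/-- The theta function `ϑ₃(v, q) = ∑ q ^ (n ^ 2) e ^ (2 n i v)`, `q = e(z)`. -/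
def theta3 (z v : ℂ) : ℂ :=
  ∑' n : ℤ, qpow z ((n : ℂ) ^ 2) * exp (2 * (n : ℂ) * I * v)

/-- The elliptic modulus `m(q) = ϑ₂(q)² / ϑ₃(q)²`, `q = e(z)`. -/
def modulus (z : ℂ) : ℂ := theta2 z 0 ^ 2 / theta3 z 0 ^ 2

/-- The complete elliptic integral `K(k) = (π / 2) ₂F₁(1/2, 1/2; 1; k²)`, through the power series
of the hypergeometric function (used for `0 < k < 1` only). -/
def ellipticK (k : ℂ) : ℂ :=
  Real.pi / 2 * ordinaryHypergeometric (1 / 2 : ℂ) (1 / 2 : ℂ) (1 : ℂ) (k ^ 2)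

/-- `F` is an analytic continuation to the upper half plane of the values that `f` takes on the
positive imaginary axis, which is where `0 < q < 1`. -/
def IsContinuation (f F : ℂ → ℂ) : Prop :=
  DifferentiableOn ℂ F upperHalf ∧ ∀ y : ℝ, 0 < y → F (I * y) = f (I * y)

/-- Analytic continuations from the imaginary axis are unique. -/
theorem IsContinuation.eqOn {f F G : ℂ → ℂ} (hF : IsContinuation f F) (hG : IsContinuation f G) :
    Set.EqOn F G upperHalf := by
  have ho : IsOpen upperHalf := isOpen_lt continuous_const Complex.continuous_im
  have hc : IsPreconnected upperHalf := (convex_halfSpace_im_gt 0).isPreconnected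
  have hI : I ∈ upperHalf := by simp [upperHalf]
  refine (hF.1.analyticOnNhd ho).eqOn_of_preconnected_of_frequently_eq
    (hG.1.analyticOnNhd ho) hc hI ?_
  have ht : Filter.Tendsto (fun y : ℝ => I * (y : ℂ)) (nhdsWithin 1 {(1 : ℝ)}ᶜ)
      (nhdsWithin I {I}ᶜ) := by
    refine tendsto_nhdsWithin_iff.2 ⟨?_, ?_⟩
    · have h : Continuous fun y : ℝ => I * (y : ℂ) := by fun_prop
      have h1 := h.tendsto 1
      simp only [ofReal_one, mul_one] at h1
      exact h1.mono_left nhdsWithin_le_nhds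
    · filter_upwards [self_mem_nhdsWithin] with y hy
      simp only [Set.mem_compl_iff, Set.mem_singleton_iff] at hy ⊢
      intro h
      apply hy
      have h2 := congrArg Complex.im h
      simpa using h2
  refine ht.frequently (Filter.Eventually.frequently ?_)
  have hp : ∀ᶠ y : ℝ in nhdsWithin 1 {(1 : ℝ)}ᶜ, 0 < y :=
    nhdsWithin_le_nhds (lt_mem_nhds one_pos)
  filter_upwards [hp] with y hy
  rw [hF.2 y hy, hG.2 y hy]

open Classical in
/-- The analytic continuation of `f` from the positive imaginary axis to the upper half plane. -/
def continuation (f : ℂ → ℂ) : ℂ → ℂ :=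
  if h : ∃ F : ℂ → ℂ, IsContinuation f F then h.choose else 0

theorem isContinuation_continuation {f F : ℂ → ℂ} (hF : IsContinuation f F) :
    IsContinuation f (continuation f) := by
  have h : ∃ F : ℂ → ℂ, IsContinuation f F := ⟨F, hF⟩
  rw [continuation, dif_pos h]
  exact h.choose_spec

/-- `√(1 - m(q)²)`, principal value. -/
def compModulusAxis (z : ℂ) : ℂ := (1 - modulus z ^ 2) ^ (1 / 2 : ℂ)

/-- `K(m(q))`. -/
def quarterAxis (z : ℂ) : ℂ := ellipticK (modulus z)

/-- `K(√(1 - m(q)²))`. -/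
def quarterAxis' (z : ℂ) : ℂ := ellipticK (compModulusAxis z)

/-- The complementary modulus `m'(q)`, `q = e(z)`, `0 < im z`. -/
def compModulus : ℂ → ℂ := continuation compModulusAxis

/-- `K = K(m(q))`, `q = e(z)`, `0 < im z`. -/
def quarter : ℂ → ℂ := continuation quarterAxis

/-- `K' = K(m'(q))`, `q = e(z)`, `0 < im z`. -/
def quarter' : ℂ → ℂ := continuation quarterAxis'

/-- The Jacobi elliptic function `cd(q, u) = cn(q, u) / dn(q, u)` as a quotient of theta functions,
`cd(q, u) = (ϑ₃(0) / ϑ₂(0)) (ϑ₂(v) / ϑ₃(v))` with `v = π u / (2 K)`. -/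
def cd (z u : ℂ) : ℂ :=
  theta3 z 0 / theta2 z 0 *
    (theta2 z (Real.pi * u / (2 * quarter z)) / theta3 z (Real.pi * u / (2 * quarter z)))

/-- The terms of the series in `cd₁`. -/
def cd1Term (z u : ℂ) (n : ℕ) : ℂ :=
  (-1) ^ n * qpow z ((n : ℂ) + 1 / 2) *
    cos ((2 * (n : ℂ) + 3) * (Real.pi / (2 * quarter z)) * u) / (1 - qpow z (2 * (n : ℂ) + 1))

/-- The function `cd₁(q, u)`, `q = e(z)`. -/
def cd1 (z u : ℂ) : ℂ := 2 * Real.pi / (quarter z * modulus z) * ∑' n : ℕ, cd1Term z u n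

/-- The terms of the series in `ss`. -/
def ssTerm (z u : ℂ) (n : ℕ) : ℂ :=
  qpow z ((n : ℂ) + 1 / 2) *
    sin ((2 * (n : ℂ) + 1) * (Real.pi / (2 * quarter z)) * u) / (1 + qpow z (2 * (n : ℂ) + 1))

/-- The function `ss(q, u)`, `q = e(z)`. Since `-q = e(z + 1/2)`, the value `ss(-q, u)` is
`ss (z + 1/2) u`. -/
def ss (z u : ℂ) : ℂ := 2 * Real.pi / (quarter z * modulus z) * ∑' n : ℕ, ssTerm z u n

/-- The principal branch of `arctanh`, analytic on the unit disc. -/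
def arctanh (w : ℂ) : ℂ := (log (1 + w) - log (1 - w)) / 2

/-- The modular angle `θ(q, u) = 2 ∑ arctanh (q ^ (n + u))`, `u > 0`; it satisfies
`exp (-θ(q, u)) = ∏ (1 - q ^ (n + u)) / ∏ (1 + q ^ (n + u))`. -/
def modularAngle (z : ℂ) (u : ℝ) : ℂ := 2 * ∑' n : ℕ, arctanh (qpow z ((n : ℂ) + (u : ℂ)))

end ModularAngle

end

namespace ModularAngle

open Complex Filter Topology

/-! Put v = πθ₀/(2K). The choice of θ₀ makes v = -π/2 + (2a-1)πz, so e^{2iv} = -q^{2a-1}, and every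
quantity in the theorem becomes a combination of two values L_a, L_{1-a} of one Lambert series L_s =
Σ_n q^{(2n+1)s}/(1-q^{2n+1}) = Σ_j q^{j+s}/(1-q^{2(j+s)}) (`oddLambert`). The series of cd₁ and ss
give the first form once cos and sin are split into exponentials (`hasSum_cos_shiftArg`,
`hasSum_sin_shiftArg`). Differentiating the modular angle termwise gives the second form, θ'(a) =
4πi z L_a (`hasDerivAt_modularAngle`). The two evaluations are then linear identities in L_a and
L_{1-a}, given cd(θ₀) and the constants K, K', m, m'.

The value of cd comes from a partial fraction expansion of ϑ₂/ϑ₃ (`hasSum_partialFraction`), which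
yields ϑ₂(0)ϑ₃(0)·ϑ₂(v)/ϑ₃(v) = -2i(L_a - L_{1-a}) (`theta2_div_theta3_shift`). The expansion
carries an unknown constant depending on z alone; `heckeSum_eq` evaluates it.

The constants are theta expressions: K = (π/2)ϑ₃², K' = -πi z ϑ₃², m' = ϑ₃(-q)²/ϑ₃(q)². On the
imaginary axis these follow from Landen's transformation and the inversion z ↦ -1/(4z); elsewhere
they follow by uniqueness of continuation.

One device recurs: the doubling z ↦ 2z squares the nome, so iterating it sends q to 0, where theta
series reduce to their constant terms. A vanishing or a ratio preserved by doubling can therefore be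
decided in the limit. This gives the nonvanishing of theta functions, the formula for K and the
constant in the partial fractions. -/

/-! ### Theta functions and their doubling identities. -/

/-- The lattice `ℤ × ℤ` as two copies of itself, through `(j, k) ↦ (j + k, j - k)` and
`(j, k) ↦ (j + k + 1, j - k)`. -/
noncomputable def parityEquiv : (ℤ × ℤ) ⊕ (ℤ × ℤ) ≃ ℤ × ℤ :=
  Equiv.ofBijective
    (Sum.elim (fun p => (p.1 + p.2, p.1 - p.2)) (fun p => (p.1 + p.2 + 1, p.1 - p.2))) <| by
    constructor
    · rintro (⟨j, k⟩ | ⟨j, k⟩) (⟨j', k'⟩ | ⟨j', k'⟩) h <;>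
        simp only [Sum.elim_inl, Sum.elim_inr, Prod.mk.injEq, Sum.inl.injEq, Sum.inr.injEq,
          reduceCtorEq] at h ⊢ <;> omega
    · rintro ⟨m, n⟩
      rcases Int.even_or_odd' (m + n) with ⟨s, hs | hs⟩
      · exact ⟨Sum.inl (s, m - s), by simp; omega⟩
      · exact ⟨Sum.inr (s, m - s - 1), by simp; omega⟩

/-- The product of two bilateral series, split by the parity of the sum of the indices. -/
theorem tsum_mul_tsum_of_parity {f g F G F' G' : ℤ → ℂ} (hf : Summable f) (hg : Summable g)
    (hF : Summable F) (hG : Summable G) (hF' : Summable F') (hG' : Summable G')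
    (h₀ : ∀ j k, f (j + k) * g (j - k) = F j * G k)
    (h₁ : ∀ j k, f (j + k + 1) * g (j - k) = F' j * G' k) :
    (∑' n, f n) * ∑' n, g n = (∑' n, F n) * (∑' n, G n) + (∑' n, F' n) * ∑' n, G' n := by
  have key : ∀ {a b : ℤ → ℂ}, Summable a → Summable b →
      HasSum (fun p : ℤ × ℤ => a p.1 * b p.2) ((∑' n, a n) * ∑' n, b n) := fun ha hb =>
    ha.hasSum.mul hb.hasSum (summable_mul_of_summable_norm ha.norm hb.norm)
  have h2 : HasSum ((fun p : ℤ × ℤ => f p.1 * g p.2) ∘ parityEquiv)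
      ((∑' n, F n) * (∑' n, G n) + (∑' n, F' n) * ∑' n, G' n) := by
    apply HasSum.sum
    · convert key hF hG using 1
      ext p
      exact h₀ p.1 p.2
    · convert key hF' hG' using 1
      ext p
      exact h₁ p.1 p.2
  exact (key hf hg).unique ((Equiv.hasSum_iff parityEquiv).1 h2)

/-- The general term of `ϑ₃`. -/
noncomputable def theta3Term (z v : ℂ) (n : ℤ) : ℂ :=
  qpow z ((n : ℂ) ^ 2) * exp (2 * (n : ℂ) * I * v)

/-- The general term of `ϑ₂`. -/
noncomputable def theta2Term (z v : ℂ) (n : ℤ) : ℂ :=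
  qpow z (((n : ℂ) + 1 / 2) ^ 2) * exp ((2 * (n : ℂ) + 1) * I * v)

theorem theta3_eq_tsum (z v : ℂ) : theta3 z v = ∑' n, theta3Term z v n := rfl

theorem theta2_eq_tsum (z v : ℂ) : theta2 z v = ∑' n, theta2Term z v n := rfl

theorem theta3Term_eq (z v : ℂ) (n : ℤ) :
    theta3Term z v n = jacobiTheta₂_term n (v / Real.pi) (2 * z) := by
  have hpi : (Real.pi : ℂ) ≠ 0 := ofReal_ne_zero.2 Real.pi_ne_zero
  rw [theta3Term, qpow, jacobiTheta₂_term, ← exp_add]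
  congr 1
  field_simp
  ring

theorem theta2Term_eq (z v : ℂ) (n : ℤ) :
    theta2Term z v n =
      qpow z (1 / 4) * exp (I * v) * jacobiTheta₂_term n (v / Real.pi + z) (2 * z) := by
  have hpi : (Real.pi : ℂ) ≠ 0 := ofReal_ne_zero.2 Real.pi_ne_zero
  rw [theta2Term, qpow, qpow, jacobiTheta₂_term, ← exp_add, ← exp_add, ← exp_add]
  congr 1
  field_simp
  ring

theorem theta3_eq_jacobiTheta₂ (z v : ℂ) : theta3 z v = jacobiTheta₂ (v / Real.pi) (2 * z) := by
  simp_rw [theta3_eq_tsum, theta3Term_eq, jacobiTheta₂]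

theorem theta2_eq_jacobiTheta₂ (z v : ℂ) : theta2 z v =
    qpow z (1 / 4) * exp (I * v) * jacobiTheta₂ (v / Real.pi + z) (2 * z) := by
  simp_rw [theta2_eq_tsum, theta2Term_eq, jacobiTheta₂, tsum_mul_left]

theorem im_two_mul_pos {z : ℂ} (hz : 0 < z.im) : 0 < (2 * z).im := by simpa using hz

theorem im_add_half {z : ℂ} : (z + 1 / 2).im = z.im := by simp

theorem summable_theta3Term {z : ℂ} (hz : 0 < z.im) (v : ℂ) : Summable (theta3Term z v) := by
  simp_rw [funext (theta3Term_eq z v)]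
  exact (summable_jacobiTheta₂_term_iff _ _).2 (im_two_mul_pos hz)

theorem summable_theta2Term {z : ℂ} (hz : 0 < z.im) (v : ℂ) : Summable (theta2Term z v) := by
  simp_rw [funext (theta2Term_eq z v)]
  exact ((summable_jacobiTheta₂_term_iff _ _).2 (im_two_mul_pos hz)).mul_left _

theorem theta3_mul_theta3 {z : ℂ} (hz : 0 < z.im) (v w : ℂ) :
    theta3 z v * theta3 z w = theta3 (2 * z) (v + w) * theta3 (2 * z) (v - w) +
      theta2 (2 * z) (v + w) * theta2 (2 * z) (v - w) := by
  have hz2 := im_two_mul_pos hz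
  refine tsum_mul_tsum_of_parity (summable_theta3Term hz v) (summable_theta3Term hz w)
    (summable_theta3Term hz2 (v + w)) (summable_theta3Term hz2 (v - w))
    (summable_theta2Term hz2 (v + w)) (summable_theta2Term hz2 (v - w)) ?_ ?_ <;> intro j k
  · simp only [qpow, ← exp_add]
    congr 1
    push_cast
    ring
  · simp only [qpow, ← exp_add]
    congr 1
    push_cast
    ring

theorem theta2_mul_theta2 {z : ℂ} (hz : 0 < z.im) (v w : ℂ) :
    theta2 z v * theta2 z w = theta2 (2 * z) (v + w) * theta3 (2 * z) (v - w) +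
      theta3 (2 * z) (v + w) * theta2 (2 * z) (v - w) := by
  have hz2 := im_two_mul_pos hz
  -- In the even class the first index is the half-integer j + k + 1/2 and in the odd class the
  -- integer j + k + 1, so ϑ₃ has to be reindexed by one to match.
  have e : theta3 (2 * z) (v + w) = ∑' n, theta3Term (2 * z) (v + w) (n + 1) :=
    ((Equiv.addRight (1 : ℤ)).tsum_eq _).symm
  rw [e]
  refine tsum_mul_tsum_of_parity (summable_theta2Term hz v) (summable_theta2Term hz w)
    (summable_theta2Term hz2 (v + w)) (summable_theta3Term hz2 (v - w))
    ((Equiv.addRight (1 : ℤ)).summable_iff.2 (summable_theta3Term hz2 (v + w)))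
    (summable_theta2Term hz2 (v - w)) ?_ ?_ <;>
    intro j k
  · simp only [qpow, ← exp_add]
    congr 1
    push_cast
    ring
  · simp only [theta3Term, qpow, ← exp_add]
    congr 1
    push_cast
    ring

theorem exp_eq_exp_of_int {a b : ℂ} (k : ℤ) (h : a = b + k * (2 * Real.pi * I)) :
    exp a = exp b :=
  exp_eq_exp_iff_exists_int.2 ⟨k, h⟩

/-- `∑ (-1) ^ n q ^ (2 (n + 1/2) ^ 2) e ^ ((2 n + 1) i v)`, a multiple of `ϑ₁`. -/
theorem tsum_theta1Term_zero (z : ℂ) :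
    ∑' n : ℤ, exp (Real.pi * I * n) * theta2Term z 0 n = 0 := by
  have h : ∑' n : ℤ, exp (Real.pi * I * n) * theta2Term z 0 n =
      ∑' n : ℤ, -(exp (Real.pi * I * n) * theta2Term z 0 n) := by
    -- The reflection n ↦ -1 - n preserves (n + 1/2)² and reverses the sign (-1)^n.
    rw [← (Equiv.subLeft (-1 : ℤ)).tsum_eq]
    refine tsum_congr fun n => ?_
    have e1 : exp (Real.pi * I * ((-1 - n : ℤ) : ℂ)) = -exp (Real.pi * I * n) := by
      rw [← neg_one_mul (exp _), ← exp_pi_mul_I, ← exp_add]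
      refine exp_eq_exp_of_int (-1 - n) ?_
      push_cast
      ring
    have e2 : theta2Term z 0 (-1 - n) = theta2Term z 0 n := by
      simp only [theta2Term, qpow, ← exp_add]
      congr 1
      push_cast
      ring
    rw [Equiv.subLeft_apply, e1, e2, neg_mul]
  rw [tsum_neg] at h
  exact self_eq_neg.1 h

theorem norm_exp_pi_mul_I_mul_int (n : ℤ) : ‖exp (Real.pi * I * n)‖ = 1 := by
  rw [norm_exp]
  simp

/-- Passing to z + 1/2 inserts the sign (-1)^n = (-1)^(j-k), which is shared between the two new
factors. The odd class then contains the factor ϑ₁(0) = 0 and only the even class survives. A zero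
of the left side is thereby inherited at 2z, which drives the nonvanishing proofs. -/
theorem theta3_mul_theta3_add_half {z : ℂ} (hz : 0 < z.im) (v : ℂ) :
    theta3 z v * theta3 (z + 1 / 2) v =
      theta3 (2 * z + 1 / 2) (2 * v) * theta3 (2 * z + 1 / 2) 0 := by
  have hz2 := im_two_mul_pos hz
  have hh : 0 < (2 * z + 1 / 2).im := by rwa [im_add_half]
  have hs : ∀ w, Summable fun n : ℤ => exp (Real.pi * I * n) * theta2Term (2 * z) w n := fun w =>
    ((summable_theta2Term hz2 w).norm.congr fun n => by
      rw [norm_mul, norm_exp_pi_mul_I_mul_int, one_mul]).of_norm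
  have := tsum_mul_tsum_of_parity (summable_theta3Term hz v)
    (summable_theta3Term (z := z + 1 / 2) (by rwa [im_add_half]) v)
    (summable_theta3Term hh (2 * v)) (summable_theta3Term hh 0) (hs (2 * v)) (hs 0) ?_ ?_
  · rw [tsum_theta1Term_zero, mul_zero, add_zero] at this
    exact this
  · intro j k
    simp only [theta3Term, qpow, ← exp_add]
    refine exp_eq_exp_of_int (-(j * k)) ?_
    push_cast
    ring
  · intro j k
    simp only [theta3Term, theta2Term, qpow, ← exp_add]
    obtain ⟨r, hr⟩ := Int.even_mul_succ_self (j - k)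
    have hr' : ((j : ℂ) - k) * ((j - k) + 1) = r + r := by exact_mod_cast hr
    refine exp_eq_exp_of_int (r - j) ?_
    push_cast
    linear_combination (Real.pi * I) * hr'

theorem theta3_add_one (z v : ℂ) : theta3 (z + 1) v = theta3 z v := by
  rw [theta3_eq_jacobiTheta₂, theta3_eq_jacobiTheta₂, mul_add, mul_one, jacobiTheta₂_add_right]

theorem theta2_add_half (z v : ℂ) : theta2 (z + 1 / 2) v = exp (Real.pi * I / 4) * theta2 z v := by
  rw [theta2_eq_tsum, theta2_eq_tsum, ← tsum_mul_left]
  refine tsum_congr fun n => ?_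
  simp only [theta2Term, qpow, ← exp_add]
  obtain ⟨r, hr⟩ := Int.even_mul_succ_self n
  have hr' : (n : ℂ) * (n + 1) = r + r := by exact_mod_cast hr
  refine exp_eq_exp_of_int r ?_
  linear_combination (Real.pi * I) * hr'

theorem theta2_add_half_sq (z v : ℂ) : theta2 (z + 1 / 2) v ^ 2 = I * theta2 z v ^ 2 := by
  have h : exp (Real.pi * I / 4) ^ 2 = I := by
    rw [← exp_nat_mul]
    refine Eq.trans ?_ exp_pi_div_two_mul_I
    congr 1
    push_cast
    ring
  rw [theta2_add_half, mul_pow, h]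

theorem theta3_sq {z : ℂ} (hz : 0 < z.im) :
    theta3 z 0 ^ 2 = theta3 (2 * z) 0 ^ 2 + theta2 (2 * z) 0 ^ 2 := by
  have := theta3_mul_theta3 hz 0 0
  simp only [add_zero, sub_zero] at this
  simpa only [sq] using this

theorem theta2_sq {z : ℂ} (hz : 0 < z.im) :
    theta2 z 0 ^ 2 = 2 * theta2 (2 * z) 0 * theta3 (2 * z) 0 := by
  have := theta2_mul_theta2 hz 0 0
  simp only [add_zero, sub_zero] at this
  rw [sq, this]
  ring

/-- This is `theta3_sq` at z + 1/2: doubling turns the half shift into a full one, which fixes ϑ₃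
and changes the sign of ϑ₂². -/
theorem theta4_sq {z : ℂ} (hz : 0 < z.im) :
    theta3 (z + 1 / 2) 0 ^ 2 = theta3 (2 * z) 0 ^ 2 - theta2 (2 * z) 0 ^ 2 := by
  have h := theta3_sq (z := z + 1 / 2) (by rwa [im_add_half])
  have e : 2 * (z + 1 / 2) = 2 * z + 1 := by ring
  have e2 : theta2 (2 * z + 1) 0 ^ 2 = - theta2 (2 * z) 0 ^ 2 := by
    have : 2 * z + 1 = 2 * z + 1 / 2 + 1 / 2 := by ring
    rw [this, theta2_add_half_sq, theta2_add_half_sq, ← mul_assoc, I_mul_I, neg_one_mul]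
  rw [h, e, theta3_add_one, e2, sub_eq_add_neg]

theorem theta3_mul_theta4 {z : ℂ} (hz : 0 < z.im) :
    theta3 z 0 * theta3 (z + 1 / 2) 0 = theta3 (2 * z + 1 / 2) 0 ^ 2 := by
  have := theta3_mul_theta3_add_half hz 0
  rw [mul_zero] at this
  rw [this, sq]

/-- With A = ϑ₃ and B = ϑ₂ at 2z, this is (A² + B²)² = (2AB)² + (A² - B²)². -/
theorem jacobi_identity {z : ℂ} (hz : 0 < z.im) :
    theta3 z 0 ^ 4 = theta2 z 0 ^ 4 + theta3 (z + 1 / 2) 0 ^ 4 := by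
  linear_combination (theta3 z 0 ^ 2 + theta3 (2 * z) 0 ^ 2 + theta2 (2 * z) 0 ^ 2) * theta3_sq hz
    - (theta3 (z + 1 / 2) 0 ^ 2 + theta3 (2 * z) 0 ^ 2 - theta2 (2 * z) 0 ^ 2) * theta4_sq hz
    - (theta2 z 0 ^ 2 + 2 * theta2 (2 * z) 0 * theta3 (2 * z) 0) * theta2_sq hz

/-! ### Nonvanishing of theta functions by repeated squaring of the nome. -/

theorem norm_qpow (z : ℂ) (s : ℝ) : ‖qpow z s‖ = Real.exp (-(2 * Real.pi * s * z.im)) := by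
  rw [qpow, norm_exp]
  congr 1
  simp [mul_re, mul_im]
  ring

theorem qpow_zero (z : ℂ) : qpow z 0 = 1 := by simp [qpow]

theorem qpow_ne_zero (z s : ℂ) : qpow z s ≠ 0 := exp_ne_zero _

theorem qpow_add (z s t : ℂ) : qpow z (s + t) = qpow z s * qpow z t := by
  rw [qpow, qpow, qpow, ← exp_add, mul_add]

theorem im_two_pow_mul (z : ℂ) (k : ℕ) : (2 ^ k * z).im = 2 ^ k * z.im := by
  have : (2 ^ k * z : ℂ) = ((2 ^ k : ℝ) : ℂ) * z := by push_cast; rfl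
  rw [this, im_ofReal_mul]

theorem im_two_pow_mul_pos {z : ℂ} (hz : 0 < z.im) (k : ℕ) : 0 < (2 ^ k * z).im := by
  rw [im_two_pow_mul]
  positivity

theorem norm_qpow_two_pow_le {z : ℂ} (hz : 0 < z.im) {s : ℝ} (hs : 0 ≤ s) (k : ℕ) :
    ‖qpow (2 ^ k * z) s‖ ≤ ‖qpow z s‖ := by
  rw [norm_qpow, norm_qpow, im_two_pow_mul, Real.exp_le_exp, neg_le_neg_iff]
  have h1 : (1 : ℝ) ≤ 2 ^ k := one_le_pow₀ (by norm_num)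
  gcongr
  nlinarith

theorem tendsto_qpow_two_pow {z : ℂ} (hz : 0 < z.im) {s : ℝ} (hs : 0 < s) :
    Tendsto (fun k : ℕ => qpow (2 ^ k * z) s) atTop (𝓝 0) := by
  rw [tendsto_zero_iff_norm_tendsto_zero]
  simp_rw [norm_qpow, im_two_pow_mul]
  refine Real.tendsto_exp_neg_atTop_nhds_zero.comp ?_
  have h2 : Tendsto (fun k : ℕ => (2 : ℝ) ^ k) atTop atTop :=
    tendsto_pow_atTop_atTop_of_one_lt (by norm_num)
  have := h2.const_mul_atTop (show 0 < 2 * Real.pi * s * z.im by positivity)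
  refine this.congr fun k => ?_
  ring

/-- A series of nonnegative powers of the nome tends to its constant term as the nome is squared
again and again. -/
theorem tendsto_tsum_qpow_two_pow {z : ℂ} (hz : 0 < z.im) {c : ℤ → ℂ} (hc : ∀ n, ‖c n‖ ≤ 1)
    {e : ℤ → ℝ} (he : ∀ n, 0 ≤ e n) (hs : Summable fun n => ‖qpow z (e n)‖) :
    Tendsto (fun k : ℕ => ∑' n, c n * qpow (2 ^ k * z) (e n)) atTop
      (𝓝 (∑' n, if e n = 0 then c n else 0)) := by
  refine tendsto_tsum_of_dominated_convergence hs (fun n => ?_) (.of_forall fun k n => ?_)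
  · split_ifs with h
    · simp [h, qpow_zero]
    · simpa using (tendsto_qpow_two_pow hz ((he n).lt_of_ne' h)).const_mul (c n)
  · rw [norm_mul]
    calc _ ≤ 1 * ‖qpow (2 ^ k * z) (e n)‖ := by gcongr; exact hc n
      _ ≤ _ := by rw [one_mul]; exact norm_qpow_two_pow_le hz (he n) k

theorem tsum_ite_eq_zero_of_unique {e : ℤ → ℝ} {c : ℤ → ℂ} (he : ∀ n, e n = 0 ↔ n = 0) :
    (∑' n, if e n = 0 then c n else 0) = c 0 := by
  simp_rw [he]
  exact tsum_ite_eq 0 c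

theorem summable_norm_qpow_sq {z : ℂ} (hz : 0 < z.im) :
    Summable fun n : ℤ => ‖qpow z (((n : ℝ) ^ 2 : ℝ) : ℂ)‖ := by
  refine (summable_theta3Term hz 0).norm.congr fun n => ?_
  simp [theta3Term]

theorem tendsto_theta3_two_pow {z : ℂ} (hz : 0 < z.im) :
    Tendsto (fun k : ℕ => theta3 (2 ^ k * z) 0) atTop (𝓝 1) := by
  have := tendsto_tsum_qpow_two_pow hz (c := fun _ => 1) (by simp) (fun n => sq_nonneg (n : ℝ))
    (summable_norm_qpow_sq hz)
  rw [tsum_ite_eq_zero_of_unique (by simp)] at this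
  refine this.congr fun k => ?_
  simp [theta3_eq_tsum, theta3Term]

theorem theta3_add_half_sub (z v : ℂ) : theta3 (z + 1 / 2) (v - Real.pi / 2) = theta3 z v := by
  refine tsum_congr fun n => ?_
  simp only [qpow, ← exp_add]
  obtain ⟨r, hr⟩ := Int.even_mul_pred_self n
  have hr' : (n : ℂ) * (n - 1) = r + r := by exact_mod_cast hr
  refine exp_eq_exp_of_int r ?_
  linear_combination (Real.pi * I) * hr'

theorem tendsto_theta4_two_pow {z : ℂ} (hz : 0 < z.im) :
    Tendsto (fun k : ℕ => theta3 (2 ^ k * z + 1 / 2) 0) atTop (𝓝 1) := by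
  have := tendsto_tsum_qpow_two_pow hz (c := fun n => exp (Real.pi * I * n))
    (fun n => (norm_exp_pi_mul_I_mul_int n).le) (fun n => sq_nonneg (n : ℝ))
    (summable_norm_qpow_sq hz)
  rw [tsum_ite_eq_zero_of_unique (by simp)] at this
  simp only [Int.cast_zero, mul_zero, exp_zero] at this
  refine this.congr fun k => ?_
  have h := theta3_add_half_sub (2 ^ k * z) (Real.pi / 2)
  rw [sub_self] at h
  rw [h, theta3_eq_tsum]
  refine tsum_congr fun n => ?_
  rw [theta3Term, mul_comm]
  congr 2
  · push_cast; rfl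
  · ring

theorem eventually_of_doubling {P : ℂ → Prop} (h : ∀ z : ℂ, 0 < z.im → P z → P (2 * z)) {z : ℂ}
    (hz : 0 < z.im) (hP : P z) (k : ℕ) : P (2 ^ k * z) := by
  induction k with
  | zero => simpa using hP
  | succ k ih =>
    have := h _ (im_two_pow_mul_pos hz k) ih
    rwa [← mul_assoc, ← pow_succ'] at this

/-- A zero at z would propagate to every 2^k z, contradicting a nonzero limit. -/
theorem ne_zero_of_doubling {f : ℂ → ℂ} (h : ∀ z : ℂ, 0 < z.im → f z = 0 → f (2 * z) = 0) {z : ℂ}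
    (hz : 0 < z.im) {l : ℂ} (hl : l ≠ 0) (ht : Tendsto (fun k : ℕ => f (2 ^ k * z)) atTop (𝓝 l)) :
    f z ≠ 0 := fun h0 => hl <| tendsto_nhds_unique
  (ht.congr fun k => eventually_of_doubling (P := fun z => f z = 0) h hz h0 k) tendsto_const_nhds

theorem theta4_ne_zero {z : ℂ} (hz : 0 < z.im) : theta3 (z + 1 / 2) 0 ≠ 0 := by
  refine ne_zero_of_doubling (f := fun z => theta3 (z + 1 / 2) 0) (fun z hz h => ?_) hz
    one_ne_zero (tendsto_theta4_two_pow hz)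
  have := theta3_mul_theta4 hz
  rw [h, mul_zero] at this
  exact pow_eq_zero_iff two_ne_zero |>.1 this.symm

theorem theta3_ne_zero {z : ℂ} (hz : 0 < z.im) : theta3 z 0 ≠ 0 := fun h => by
  have := theta3_mul_theta4 hz
  rw [h, zero_mul] at this
  exact theta4_ne_zero (im_two_mul_pos hz) (pow_eq_zero_iff two_ne_zero |>.1 this.symm)

theorem summable_norm_qpow_mul_succ {z : ℂ} (hz : 0 < z.im) :
    Summable fun n : ℤ => ‖qpow z (((n : ℝ) ^ 2 + n : ℝ) : ℂ)‖ := by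
  have h : ∀ n : ℤ, ‖qpow z (((n : ℝ) ^ 2 + n : ℝ) : ℂ)‖ =
      ‖qpow z (((-(1 / 4) : ℝ)) : ℂ)‖ * ‖theta2Term z 0 n‖ := fun n => by
    rw [theta2Term, ← norm_mul, mul_zero, exp_zero, mul_one, ← qpow_add]
    congr 2
    push_cast
    ring
  simp_rw [h]
  exact (summable_theta2Term hz 0).norm.mul_left _

theorem theta2_zero_eq (z : ℂ) :
    theta2 z 0 = qpow z (1 / 4) * ∑' n : ℤ, qpow z (((n : ℝ) ^ 2 + n : ℝ) : ℂ) := by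
  rw [theta2_eq_tsum, ← tsum_mul_left]
  refine tsum_congr fun n => ?_
  rw [theta2Term, mul_zero, exp_zero, mul_one, ← qpow_add]
  congr 1
  push_cast
  ring

/-- ϑ₂ itself tends to 0 with the nome, so the factor q^{1/4} is removed first. The remaining
exponents n² + n vanish for n = 0 and n = -1, hence the limit 2. -/
theorem theta2_ne_zero {z : ℂ} (hz : 0 < z.im) : theta2 z 0 ≠ 0 := by
  have hsum := tendsto_tsum_qpow_two_pow hz (c := fun _ => 1) (by simp)
    (e := fun n => (n : ℝ) ^ 2 + n)
    (fun n => by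
      have : 0 ≤ n ^ 2 + n := by
        rcases le_or_gt 0 n with h | h <;> nlinarith
      exact_mod_cast this)
    (summable_norm_qpow_mul_succ hz)
  have hl : (∑' n : ℤ, if (n : ℝ) ^ 2 + n = 0 then (1 : ℂ) else 0) = 2 := by
    have : ∀ n : ℤ, (n : ℝ) ^ 2 + n = 0 ↔ n ∈ ({0, -1} : Finset ℤ) := fun n => by
      rw [Finset.mem_insert, Finset.mem_singleton]
      have : (n : ℝ) ^ 2 + n = ((n * (n + 1) : ℤ) : ℝ) := by push_cast; ring
      rw [this, Int.cast_eq_zero, mul_eq_zero]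
      omega
    simp_rw [this]
    rw [tsum_eq_sum (s := {0, -1}) (fun n hn => if_neg hn),
      Finset.sum_congr rfl (fun n hn => if_pos hn)]
    simp
  rw [hl] at hsum
  simp only [one_mul] at hsum
  rw [theta2_zero_eq]
  refine mul_ne_zero (qpow_ne_zero _ _) ?_
  refine ne_zero_of_doubling (f := fun z => ∑' n : ℤ, qpow z (((n : ℝ) ^ 2 + n : ℝ) : ℂ))
    (fun z hz h => ?_) hz two_ne_zero hsum
  have h1 : theta2 z 0 = 0 := by rw [theta2_zero_eq, h, mul_zero]
  have h2 := theta2_sq hz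
  rw [h1, theta2_zero_eq] at h2
  simpa [qpow_ne_zero, theta3_ne_zero (im_two_mul_pos hz)] using h2

theorem modulus_ne_zero {z : ℂ} (hz : 0 < z.im) : modulus z ≠ 0 :=
  div_ne_zero (pow_ne_zero _ (theta2_ne_zero hz)) (pow_ne_zero _ (theta3_ne_zero hz))

theorem one_sub_modulus_sq {z : ℂ} (hz : 0 < z.im) :
    1 - modulus z ^ 2 = (theta3 (z + 1 / 2) 0 ^ 2 / theta3 z 0 ^ 2) ^ 2 := by
  have h := theta3_ne_zero hz
  have hj := jacobi_identity hz
  rw [modulus]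
  generalize theta3 (z + 1 / 2) 0 = t at hj ⊢
  field_simp
  linear_combination hj

theorem tendsto_modulus_two_pow {z : ℂ} (hz : 0 < z.im) :
    Tendsto (fun k : ℕ => modulus (2 ^ k * z)) atTop (𝓝 0) := by
  -- The limit is obtained for m² through 1 - m², since that is a quotient of theta functions
  -- tending to 1.
  have h1 := ((((tendsto_theta4_two_pow hz).pow 2).div ((tendsto_theta3_two_pow hz).pow 2)
    (by simp)).pow 2).const_sub 1
  have h2 : Tendsto (fun k : ℕ => modulus (2 ^ k * z) ^ 2) atTop (𝓝 0) := by
    have e : (1 - ((1 : ℂ) ^ 2 / 1 ^ 2) ^ 2) = 0 := by norm_num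
    rw [e] at h1
    refine h1.congr fun k => ?_
    have := one_sub_modulus_sq (im_two_pow_mul_pos hz k)
    simp only [Pi.div_apply]
    linear_combination this
  rw [tendsto_zero_iff_norm_tendsto_zero] at h2 ⊢
  have h3 := h2.sqrt
  simpa [norm_pow, Real.sqrt_sq] using h3

/-- `ϑ₃(v)` at `e ^ (2 i v) = -q ^ (2 a - 1)`. -/
theorem theta3_shift_eq (z : ℂ) (a : ℝ) : theta3 z (-(Real.pi / 2) + (2 * a - 1) * Real.pi * z) =
    ∑' n : ℤ, exp (Real.pi * I * n) * qpow z (((n : ℝ) ^ 2 - n + 2 * a * n : ℝ) : ℂ) := by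
  refine tsum_congr fun n => ?_
  simp only [qpow, ← exp_add]
  refine exp_eq_exp_of_int (-n) ?_
  push_cast
  ring

theorem summable_norm_qpow_shift {z : ℂ} (hz : 0 < z.im) (a : ℝ) :
    Summable fun n : ℤ => ‖qpow z (((n : ℝ) ^ 2 - n + 2 * a * n : ℝ) : ℂ)‖ := by
  refine (summable_theta3Term hz ((2 * a - 1) * Real.pi * z)).norm.congr fun n => ?_
  simp only [theta3Term, qpow, ← exp_add]
  congr 2
  push_cast
  ring

theorem sq_sub_add_nonneg {a : ℝ} (h0 : 0 < a) (h1 : a < 1) (n : ℤ) :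
    0 ≤ (n : ℝ) ^ 2 - n + 2 * a * n := by
  rcases le_or_gt 0 n with h | h
  · rcases h.eq_or_lt with h | h
    · simp [← h]
    · have h' : (1 : ℝ) ≤ n := by exact_mod_cast h
      nlinarith
  · have h' : (n : ℝ) ≤ -1 := by exact_mod_cast Int.le_sub_one_of_lt h
    nlinarith

theorem sq_sub_add_eq_zero_iff {a : ℝ} (h0 : 0 < a) (h1 : a < 1) (n : ℤ) :
    (n : ℝ) ^ 2 - n + 2 * a * n = 0 ↔ n = 0 := by
  refine ⟨fun h => ?_, fun h => by simp [h]⟩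
  by_contra hn
  rcases lt_or_gt_of_ne hn with h' | h'
  · have h' : (n : ℝ) ≤ -1 := by exact_mod_cast Int.le_sub_one_of_lt h'
    nlinarith
  · have h' : (1 : ℝ) ≤ n := by exact_mod_cast h'
    nlinarith

theorem theta3_shift_ne_zero {z : ℂ} (hz : 0 < z.im) {a : ℝ} (h0 : 0 < a) (h1 : a < 1) :
    theta3 z (-(Real.pi / 2) + (2 * a - 1) * Real.pi * z) ≠ 0 := by
  have ht := tendsto_tsum_qpow_two_pow hz (c := fun n => exp (Real.pi * I * n))
    (fun n => (norm_exp_pi_mul_I_mul_int n).le) (sq_sub_add_nonneg h0 h1)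
    (summable_norm_qpow_shift hz a)
  rw [tsum_ite_eq_zero_of_unique (sq_sub_add_eq_zero_iff h0 h1)] at ht
  simp only [Int.cast_zero, mul_zero, exp_zero, ← theta3_shift_eq] at ht
  refine ne_zero_of_doubling (f := fun z => theta3 z (-(Real.pi / 2) + (2 * a - 1) * Real.pi * z))
    (fun z hz h => ?_) hz one_ne_zero ht
  have e := theta3_mul_theta3_add_half hz (-(Real.pi / 2) + (2 * a - 1) * Real.pi * z)
  rw [h, zero_mul] at e
  -- The doubled argument is the shifted argument for 2z moved by -π/2, and that move cancels the
  -- half shift of the nome. So a zero at z gives one of the same form at 2z.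
  have e2 : 2 * (-(Real.pi / 2) + (2 * a - 1) * Real.pi * z) =
      (-(Real.pi / 2) + (2 * a - 1) * Real.pi * (2 * z)) - Real.pi / 2 := by ring
  rw [e2, theta3_add_half_sub] at e
  exact (mul_eq_zero.1 e.symm).resolve_right (theta4_ne_zero (im_two_mul_pos hz))

/-! ### Landen's transformation for the hypergeometric function. -/

/-- The coefficients `(2 n)! / (2 ^ n n!) ^ 2` of `(1 - w) ^ (-1 / 2)`. -/
noncomputable def halfCoeff (n : ℕ) : ℝ := ∏ i ∈ Finset.range n, (2 * (i : ℝ) + 1) / (2 * i + 2)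

theorem halfCoeff_pos (n : ℕ) : 0 < halfCoeff n := Finset.prod_pos fun _ _ => by positivity

theorem halfCoeff_le_one (n : ℕ) : halfCoeff n ≤ 1 :=
  Finset.prod_le_one (fun _ _ => by positivity) fun i _ => by
    rw [div_le_one (by positivity)]
    linarith

theorem norm_halfCoeff_le_one (n : ℕ) : ‖(halfCoeff n : ℂ)‖ ≤ 1 := by
  rw [norm_real, Real.norm_of_nonneg (halfCoeff_pos n).le]
  exact halfCoeff_le_one n

theorem ascPochhammer_half (n : ℕ) :
    (n.factorial : ℂ)⁻¹ * (ascPochhammer ℂ n).eval (1 / 2) = halfCoeff n := by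
  induction n with
  | zero => simp [halfCoeff]
  | succ n ih =>
    have h : halfCoeff (n + 1) = halfCoeff n * ((2 * (n : ℝ) + 1) / (2 * n + 2)) :=
      Finset.prod_range_succ _ n
    have h1 : (n : ℂ) + 1 ≠ 0 := by exact_mod_cast n.succ_ne_zero
    have h2 : (n.factorial : ℂ) ≠ 0 := by exact_mod_cast n.factorial_ne_zero
    rw [h, ofReal_mul, ← ih, ascPochhammer_succ_eval, Nat.factorial_succ]
    push_cast
    have h3 : 2 * (n : ℂ) + 2 = 2 * (n + 1) := by ring
    rw [h3]
    field_simp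
    ring

theorem hypergeometric_eq_tsum (w : ℂ) :
    ordinaryHypergeometric (1 / 2 : ℂ) (1 / 2 : ℂ) (1 : ℂ) w =
      ∑' n, (halfCoeff n : ℂ) ^ 2 * w ^ n := by
  rw [ordinaryHypergeometric_eq_tsum]
  refine tsum_congr fun n => ?_
  rw [smul_eq_mul, ← ascPochhammer_half, ascPochhammer_eval_one]
  ring

theorem hasSum_halfCoeff {w : ℂ} (hw : ‖w‖ < 1) :
    HasSum (fun n => (halfCoeff n : ℂ) * w ^ n) (1 / (1 - w) ^ (1 / 2 : ℂ)) := by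
  have h := (one_div_one_sub_cpow_hasFPowerSeriesOnBall_zero (1 / 2)).hasSum (y := w)
    (by simpa [enorm_eq_nnnorm] using (by exact_mod_cast hw : ‖w‖₊ < 1))
  rw [zero_add] at h
  refine (funext fun n => ?_ : (fun n => (halfCoeff n : ℂ) * w ^ n) = _) ▸ h
  rw [FormalMultilinearSeries.ofScalars_apply_eq, smul_eq_mul, ← ascPochhammer_half,
    Ring.choose_eq_smul, Polynomial.descPochhammer_smeval_eq_ascPochhammer,
    Polynomial.ascPochhammer_smeval_cast, Polynomial.ascPochhammer_smeval_eq_eval]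
  ring_nf

theorem norm_one_div_sqrt_sq (w : ℂ) : ‖1 / w ^ (1 / 2 : ℂ)‖ ^ 2 = 1 / ‖w‖ := by
  rw [← norm_pow, div_pow, one_pow, ← cpow_nat_mul]
  norm_num

theorem hasSum_mul_hasSum {ι κ : Type*} {f : ι → ℂ} {g : κ → ℂ} {a b : ℂ} (hf : HasSum f a)
    (hg : HasSum g b) : HasSum (fun p : ι × κ => f p.1 * g p.2) (a * b) :=
  hf.mul hg (summable_mul_of_summable_norm hf.summable.norm hg.summable.norm)

/-- 1/|1 - w| is (1 - w)^{-1/2} times its complex conjugate, so it is the product of two binomial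
series. -/
theorem hasSum_halfCoeff_prod {w : ℂ} (hw : ‖w‖ < 1) :
    HasSum (fun p : ℕ × ℕ => (halfCoeff p.1 : ℂ) * w ^ p.1 * (halfCoeff p.2 *
      (starRingEnd ℂ) w ^ p.2)) ((1 / ‖1 - w‖ : ℝ) : ℂ) := by
  have h1 := hasSum_halfCoeff hw
  have h2 : HasSum (fun n => (halfCoeff n : ℂ) * (starRingEnd ℂ) w ^ n)
      ((starRingEnd ℂ) (1 / (1 - w) ^ (1 / 2 : ℂ))) := by
    have e : (fun n => (halfCoeff n : ℂ) * (starRingEnd ℂ) w ^ n) =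
        fun n => (starRingEnd ℂ) ((halfCoeff n : ℂ) * w ^ n) := funext fun n => by
      rw [map_mul, map_pow, conj_ofReal]
    rw [e]
    exact hasSum_conj'.mpr h1
  have h4 : (1 / (1 - w) ^ (1 / 2 : ℂ)) * (starRingEnd ℂ) (1 / (1 - w) ^ (1 / 2 : ℂ)) =
      ((1 / ‖1 - w‖ : ℝ) : ℂ) := by
    rw [mul_conj, normSq_eq_norm_sq, norm_one_div_sqrt_sq]
  rw [← h4]
  exact hasSum_mul_hasSum (f := fun n => (halfCoeff n : ℂ) * w ^ n)
    (g := fun n => (halfCoeff n : ℂ) * (starRingEnd ℂ) w ^ n) h1 h2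

theorem integral_exp_int (k : ℤ) :
    ∫ φ in (0 : ℝ)..Real.pi, exp (2 * k * I * φ) = if k = 0 then (Real.pi : ℂ) else 0 := by
  split_ifs with h
  · simp [h]
  · have hk : (2 * k * I : ℂ) ≠ 0 := by simp [h]
    rw [integral_exp_mul_complex hk]
    have : exp (2 * k * I * Real.pi) = exp 0 := exp_eq_exp_of_int k (by ring)
    rw [this]
    simp

/-- The integral behind Landen's transformation, as a series in `x`. -/
theorem integral_one_div_norm_eq {x : ℝ} (h0 : 0 ≤ x) (h1 : x < 1) :
    ∫ φ in (0 : ℝ)..Real.pi, ((1 / ‖1 + x * exp (2 * I * φ)‖ : ℝ) : ℂ) =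
      Real.pi * ∑' n, (halfCoeff n : ℂ) ^ 2 * ((x : ℂ) ^ 2) ^ n := by
  have hn : ∀ φ : ℝ, ‖-(x * exp (2 * I * φ))‖ = x := fun φ => by
    rw [norm_neg, norm_mul, norm_real, Real.norm_of_nonneg h0, norm_exp]
    simp
  have hx := summable_geometric_of_lt_one h0 h1
  have hb : Summable fun p : ℕ × ℕ => x ^ p.1 * x ^ p.2 :=
    hx.mul_of_nonneg hx (fun _ => by positivity) (fun _ => by positivity)
  have key := intervalIntegral.hasSum_integral_of_dominated_convergence
    (μ := MeasureTheory.volume) (a := 0) (b := Real.pi)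
    (F := fun (p : ℕ × ℕ) (φ : ℝ) => (halfCoeff p.1 : ℂ) * (-(x * exp (2 * I * φ))) ^ p.1 *
      (halfCoeff p.2 * (starRingEnd ℂ) (-(x * exp (2 * I * φ))) ^ p.2))
    (f := fun φ => ((1 / ‖1 + x * exp (2 * I * φ)‖ : ℝ) : ℂ))
    (fun p _ => x ^ p.1 * x ^ p.2)
    (fun p => by
      refine Continuous.aestronglyMeasurable ?_
      fun_prop)
    (fun p => .of_forall fun φ _ => by
      rw [norm_mul, norm_mul, norm_mul, norm_pow, norm_pow, RCLike.norm_conj, hn]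
      have a1 := norm_halfCoeff_le_one p.1
      have a2 := norm_halfCoeff_le_one p.2
      gcongr
      · exact mul_le_of_le_one_left (by positivity) a1
      · exact mul_le_of_le_one_left (by positivity) a2)
    (.of_forall fun φ _ => hb) (by simp)
    (.of_forall fun φ _ => by
      have := hasSum_halfCoeff_prod (w := -(x * exp (2 * I * φ))) (by rwa [hn])
      rwa [sub_neg_eq_add] at this)
  -- Orthogonality of the exponentials over [0, π]: only the diagonal of the double series
  -- contributes.
  have hterm : ∀ p : ℕ × ℕ, ∫ φ in (0 : ℝ)..Real.pi,
      (halfCoeff p.1 : ℂ) * (-(x * exp (2 * I * φ))) ^ p.1 *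
      (halfCoeff p.2 * (starRingEnd ℂ) (-(x * exp (2 * I * φ))) ^ p.2) =
      if p.1 = p.2 then (Real.pi : ℂ) * ((halfCoeff p.1 : ℂ) ^ 2 * ((x : ℂ) ^ 2) ^ p.1) else 0 := by
    rintro ⟨n, m⟩
    have e : ∀ φ : ℝ, (halfCoeff n : ℂ) * (-(x * exp (2 * I * φ))) ^ n *
        (halfCoeff m * (starRingEnd ℂ) (-(x * exp (2 * I * φ))) ^ m) =
        (halfCoeff n * halfCoeff m * (-x) ^ (n + m) : ℂ) *
          exp (2 * ((n - m : ℤ) : ℂ) * I * φ) := fun φ => by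
      have : exp (2 * ((n - m : ℤ) : ℂ) * I * φ) =
          exp (2 * I * φ) ^ n * exp (-(2 * I * φ)) ^ m := by
        rw [← exp_nat_mul, ← exp_nat_mul, ← exp_add]
        congr 1
        push_cast
        ring
      rw [this, map_neg, map_mul, conj_ofReal, ← exp_conj, map_mul, map_mul, conj_I, conj_ofReal,
        map_ofNat]
      have : (2 * -I * φ : ℂ) = -(2 * I * φ) := by ring
      rw [this]
      ring
    simp_rw [e]
    rw [intervalIntegral.integral_const_mul, integral_exp_int]
    by_cases h : n = m
    · subst h
      simp only [sub_self, if_true]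
      rw [← two_mul, pow_mul, neg_sq]
      ring
    · have : (n : ℤ) - m ≠ 0 := by omega
      simp [h, this]
  rw [← key.tsum_eq]
  simp_rw [hterm]
  rw [← tsum_mul_left]
  have hinj : Function.Injective fun n : ℕ => (n, n) := fun a b h => (Prod.mk.inj h).1
  rw [← hinj.tsum_eq]
  · simp
  · rintro ⟨n, m⟩ h
    by_contra hnm
    refine h (if_neg fun e => hnm ⟨n, ?_⟩)
    simp only at e
    rw [e]

/-- The same integral as a series in `4 x / (1 + x) ^ 2`. -/
theorem integral_one_div_norm_eq_landen {x : ℝ} (h0 : 0 ≤ x) (h1 : x < 1) :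
    ∫ φ in (0 : ℝ)..Real.pi, ((1 / ‖1 + x * exp (2 * I * φ)‖ : ℝ) : ℂ) =
      1 / (1 + x) * (Real.pi * ∑' n, (halfCoeff n : ℂ) ^ 2 * (4 * x / (1 + x) ^ 2 : ℂ) ^ n) := by
  set κ : ℝ := 4 * x / (1 + x) ^ 2 with hκ
  have hκ0 : 0 ≤ κ := by positivity
  have hκ1 : κ < 1 := by
    rw [hκ, div_lt_one (by positivity)]
    nlinarith [sq_pos_of_pos (sub_pos.2 h1)]
  have ht : ∀ φ : ℝ, 0 ≤ κ * Real.sin φ ^ 2 ∧ κ * Real.sin φ ^ 2 ≤ κ := fun φ =>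
    ⟨by positivity, mul_le_of_le_one_right hκ0 (Real.sin_sq_le_one φ)⟩
  -- |1 + x e^{2iφ}|² = (1 + x)² - 4x sin² φ = (1 + x)²(1 - κ sin² φ), which accounts for the choice
  -- of κ.
  have hnorm : ∀ φ : ℝ, ((1 / ‖1 + x * exp (2 * I * φ)‖ : ℝ) : ℂ) =
      1 / (1 + x) * (1 / (1 - ((κ * Real.sin φ ^ 2 : ℝ) : ℂ)) ^ (1 / 2 : ℂ)) := fun φ => by
    have hpos : 0 ≤ 1 - κ * Real.sin φ ^ 2 := by linarith [(ht φ).2]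
    have e1 : ‖1 + x * exp (2 * I * φ)‖ = (1 + x) * √(1 - κ * Real.sin φ ^ 2) := by
      rw [← Real.sqrt_sq (by positivity : 0 ≤ 1 + x), ← Real.sqrt_mul (by positivity),
        ← Real.sqrt_sq (norm_nonneg (1 + x * exp (2 * I * φ)))]
      congr 1
      have : (2 * I * φ : ℂ) = ((2 * φ : ℝ) : ℂ) * I := by push_cast; ring
      rw [this, exp_mul_I, ← ofReal_cos, ← ofReal_sin, ← normSq_eq_norm_sq, normSq_apply]
      simp only [add_re, one_re, mul_re, ofReal_re, ofReal_im, I_re, I_im, add_im, one_im, mul_im]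
      have hs := Real.sin_sq_add_cos_sq (2 * φ)
      have hc := Real.cos_sq' φ
      have hc2 := Real.cos_two_mul φ
      have hk : (1 + x) ^ 2 * κ = 4 * x := by
        rw [hκ]
        field_simp
      linear_combination x ^ 2 * hs + 2 * x * hc2 + 4 * x * hc + Real.sin φ ^ 2 * hk
    rw [e1]
    have e2 : (1 - ((κ * Real.sin φ ^ 2 : ℝ) : ℂ)) ^ (1 / 2 : ℂ) =
        ((√(1 - κ * Real.sin φ ^ 2) : ℝ) : ℂ) := by
      rw [Real.sqrt_eq_rpow, ofReal_cpow hpos]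
      push_cast
      rfl
    rw [e2]
    push_cast
    rw [one_div_mul_one_div]
  have key := intervalIntegral.hasSum_integral_of_dominated_convergence
    (μ := MeasureTheory.volume) (a := 0) (b := Real.pi)
    (F := fun (n : ℕ) (φ : ℝ) => (halfCoeff n : ℂ) * ((κ * Real.sin φ ^ 2 : ℝ) : ℂ) ^ n)
    (f := fun φ => 1 / (1 - ((κ * Real.sin φ ^ 2 : ℝ) : ℂ)) ^ (1 / 2 : ℂ))
    (fun n _ => κ ^ n)
    (fun n => by
      refine Continuous.aestronglyMeasurable ?_
      fun_prop)
    (fun n => .of_forall fun φ _ => by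
      rw [norm_mul, norm_pow, norm_real (κ * _), Real.norm_of_nonneg (ht φ).1]
      calc _ ≤ 1 * κ ^ n := mul_le_mul (norm_halfCoeff_le_one n)
            (pow_le_pow_left₀ (ht φ).1 (ht φ).2 n) (pow_nonneg (ht φ).1 n) zero_le_one
        _ = κ ^ n := one_mul _)
    (.of_forall fun φ _ => summable_geometric_of_lt_one hκ0 hκ1) (by simp)
    (.of_forall fun φ _ => hasSum_halfCoeff (by
      rw [norm_real, Real.norm_of_nonneg (ht φ).1]
      exact (ht φ).2.trans_lt hκ1))
  simp_rw [hnorm]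
  rw [intervalIntegral.integral_const_mul, ← key.tsum_eq, ← tsum_mul_left (a := (Real.pi : ℂ))]
  congr 1
  refine tsum_congr fun n => ?_
  have hi : ∫ φ in (0 : ℝ)..Real.pi, (halfCoeff n : ℂ) * ((κ * Real.sin φ ^ 2 : ℝ) : ℂ) ^ n =
      ((∫ φ in (0 : ℝ)..Real.pi, halfCoeff n * κ ^ n * Real.sin φ ^ (2 * n) : ℝ) : ℂ) := by
    rw [← intervalIntegral.integral_ofReal]
    congr 1
    ext φ
    push_cast
    ring
  rw [hi, intervalIntegral.integral_const_mul, integral_sin_pow_even]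
  -- The product in Wallis' formula for the integral of sin^{2n} over [0, π] is `halfCoeff n`, up to
  -- the factor π.
  change ((halfCoeff n * κ ^ n * (Real.pi * halfCoeff n) : ℝ) : ℂ) = _
  rw [hκ]
  push_cast
  ring

/-- Landen's transformation of the complete elliptic integral. -/
theorem hypergeometric_landen {x : ℝ} (h0 : 0 ≤ x) (h1 : x < 1) :
    ordinaryHypergeometric (1 / 2 : ℂ) (1 / 2 : ℂ) (1 : ℂ) (4 * x / (1 + x) ^ 2 : ℂ) =
      (1 + x) * ordinaryHypergeometric (1 / 2 : ℂ) (1 / 2 : ℂ) (1 : ℂ) ((x : ℂ) ^ 2) := by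
  have h := (integral_one_div_norm_eq h0 h1).symm.trans (integral_one_div_norm_eq_landen h0 h1)
  have hx : (1 + x : ℂ) ≠ 0 := by exact_mod_cast (by positivity : (1 + x : ℝ) ≠ 0)
  have hpi : (Real.pi : ℂ) ≠ 0 := ofReal_ne_zero.2 Real.pi_ne_zero
  rw [hypergeometric_eq_tsum, hypergeometric_eq_tsum]
  refine mul_left_cancel₀ hpi ?_
  rw [mul_left_comm, h, ← mul_assoc, mul_one_div_cancel hx, one_mul]

theorem continuousAt_hypergeometric_zero :
    ContinuousAt (ordinaryHypergeometric (1 / 2 : ℂ) (1 / 2 : ℂ) (1 : ℂ)) (0 : ℂ) := by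
  have hr : (ordinaryHypergeometricSeries ℂ (1 / 2 : ℂ) (1 / 2 : ℂ) (1 : ℂ)).radius = 1 := by
    refine ordinaryHypergeometricSeries_radius_eq_one _ _ _ _ fun n => ?_
    have h : ∀ r : ℝ, 0 < r → (n : ℂ) ≠ -(r : ℂ) := fun r hr e => by
      have : (n : ℝ) = -r := by exact_mod_cast e
      have := n.cast_nonneg (α := ℝ)
      linarith
    have h1 := h (1 / 2) (by norm_num)
    have h2 := h 1 (by norm_num)
    push_cast at h1 h2
    exact ⟨h1, h1, h2⟩
  exact (FormalMultilinearSeries.hasFPowerSeriesOnBall _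
    (by rw [hr]; norm_num)).hasFPowerSeriesAt.continuousAt

/-! ### The modulus, K and K' in terms of theta functions: imaginary axis, inversion, continuation.
-/

theorem qpow_I_mul (y s : ℝ) : qpow (I * y) s = (Real.exp (-(2 * Real.pi * y * s)) : ℝ) := by
  rw [qpow, ofReal_exp]
  congr 1
  push_cast
  linear_combination (2 * Real.pi * y * s : ℂ) * I_sq

theorem exists_theta3_eq_ofReal {y : ℝ} (hy : 0 < y) :
    ∃ r : ℝ, 0 < r ∧ theta3 (I * y) 0 = r := by
  have hz : 0 < (I * y : ℂ).im := by simpa using hy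
  have h : ∀ n : ℤ, theta3Term (I * y) 0 n = (Real.exp (-(2 * Real.pi * y * (n : ℝ) ^ 2)) : ℝ) :=
    fun n => by
      rw [← qpow_I_mul, theta3Term, mul_zero, exp_zero, mul_one]
      push_cast
      rfl
  have hs := summable_theta3Term hz 0
  simp_rw [funext h, summable_ofReal] at hs
  refine ⟨_, hs.tsum_pos (fun _ => (Real.exp_pos _).le) 0 (Real.exp_pos _), ?_⟩
  rw [theta3_eq_tsum, ofReal_tsum]
  exact tsum_congr h

theorem exists_theta2_eq_ofReal {y : ℝ} (hy : 0 < y) :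
    ∃ r : ℝ, 0 < r ∧ theta2 (I * y) 0 = r := by
  have hz : 0 < (I * y : ℂ).im := by simpa using hy
  have h : ∀ n : ℤ, theta2Term (I * y) 0 n =
      (Real.exp (-(2 * Real.pi * y * ((n : ℝ) + 1 / 2) ^ 2)) : ℝ) := fun n => by
    rw [← qpow_I_mul, theta2Term, mul_zero, exp_zero, mul_one]
    push_cast
    rfl
  have hs := summable_theta2Term hz 0
  simp_rw [funext h, summable_ofReal] at hs
  refine ⟨_, hs.tsum_pos (fun _ => (Real.exp_pos _).le) 0 (Real.exp_pos _), ?_⟩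
  rw [theta2_eq_tsum, ofReal_tsum]
  exact tsum_congr h

theorem exists_modulus_eq_ofReal {y : ℝ} (hy : 0 < y) :
    ∃ r : ℝ, 0 < r ∧ modulus (I * y) = r := by
  obtain ⟨r, hr, h3⟩ := exists_theta3_eq_ofReal hy
  obtain ⟨s, hs, h2⟩ := exists_theta2_eq_ofReal hy
  exact ⟨s ^ 2 / r ^ 2, by positivity, by rw [modulus, h2, h3]; push_cast; rfl⟩

section Inversion

variable {z : ℂ}

/-- Jacobi's functional equation for the lattice parameter 2z; squaring removes the branch of the
square root. -/
theorem theta3_neg_inv (hz : 0 < z.im) :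
    theta3 (-1 / (4 * z)) 0 ^ 2 = -2 * I * z * theta3 z 0 ^ 2 := by
  have hz0 : z ≠ 0 := fun h => by simp [h] at hz
  have hs : ((-I * (2 * z)) ^ (1 / 2 : ℂ)) ^ 2 = -2 * I * z := by
    rw [← cpow_nat_mul]
    norm_num
    ring
  have hs0 : (-I * (2 * z)) ^ (1 / 2 : ℂ) ≠ 0 := fun h => by
    rw [h] at hs
    simp [hz0] at hs
  have h := jacobiTheta₂_functional_equation 0 (2 * z)
  have e : -1 / (2 * z) = 2 * (-1 / (4 * z)) := by
    field_simp
    norm_num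
  rw [theta3_eq_jacobiTheta₂, theta3_eq_jacobiTheta₂, zero_div, h, e]
  simp only [ne_eq, OfNat.ofNat_ne_zero, not_false_eq_true, zero_pow, mul_zero, zero_div, exp_zero,
    mul_one]
  rw [mul_pow, div_pow, hs]
  field_simp

/-- The functional equation at the half period 1/2, which exchanges ϑ₂ and ϑ₃(-q). -/
theorem theta2_neg_inv (hz : 0 < z.im) :
    theta2 (-1 / (4 * z)) 0 ^ 2 = -2 * I * z * theta3 (z + 1 / 2) 0 ^ 2 := by
  have hz0 : z ≠ 0 := fun h => by simp [h] at hz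
  have hpi : (Real.pi : ℂ) ≠ 0 := ofReal_ne_zero.2 Real.pi_ne_zero
  have hs : ((-I * (2 * z)) ^ (1 / 2 : ℂ)) ^ 2 = -2 * I * z := by
    rw [← cpow_nat_mul]
    norm_num
    ring
  have h := jacobiTheta₂_functional_equation (1 / 2) (2 * z)
  have e : -1 / (2 * z) = 2 * (-1 / (4 * z)) := by
    field_simp
    norm_num
  have e1 : (1 / 2 : ℂ) / (2 * z) = -(-1 / (4 * z)) := by
    field_simp
    norm_num
  have e2 : theta3 (z + 1 / 2) 0 = jacobiTheta₂ (1 / 2) (2 * z) := by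
    have := theta3_add_half_sub z (Real.pi / 2)
    rw [sub_self] at this
    rw [this, theta3_eq_jacobiTheta₂]
    congr 1
    field_simp
  have e3 : qpow (-1 / (4 * z)) (1 / 4) = exp (-Real.pi * I * (1 / 2) ^ 2 / (2 * z)) := by
    rw [qpow]
    congr 1
    field_simp
    norm_num
  rw [e2, h, theta2_eq_jacobiTheta₂, mul_zero, exp_zero, zero_div, zero_add, e, e1,
    jacobiTheta₂_neg_left, e3, mul_one]
  have k : ∀ s A B : ℂ, (1 / s * A * B) ^ 2 = A ^ 2 * B ^ 2 / s ^ 2 := fun _ _ _ => by ring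
  rw [k, hs]
  field_simp

theorem modulus_neg_inv (hz : 0 < z.im) :
    modulus (-1 / (4 * z)) = theta3 (z + 1 / 2) 0 ^ 2 / theta3 z 0 ^ 2 := by
  have hz0 : z ≠ 0 := fun h => by simp [h] at hz
  have : -2 * I * z ≠ 0 := by simp [hz0]
  rw [modulus, theta3_neg_inv hz, theta2_neg_inv hz, mul_div_mul_left _ _ this]

theorem modulus_sq_eq (hz : 0 < z.im) :
    modulus z ^ 2 = 4 * modulus (2 * z) / (1 + modulus (2 * z)) ^ 2 := by
  have h3 := theta3_ne_zero (im_two_mul_pos hz)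
  have h := theta3_ne_zero hz
  have hsum := theta3_sq hz
  have h0 : theta3 (2 * z) 0 ^ 2 + theta2 (2 * z) 0 ^ 2 ≠ 0 := hsum ▸ pow_ne_zero 2 h
  rw [modulus, modulus, hsum, theta2_sq hz]
  have : 1 + theta2 (2 * z) 0 ^ 2 / theta3 (2 * z) 0 ^ 2 =
      (theta3 (2 * z) 0 ^ 2 + theta2 (2 * z) 0 ^ 2) / theta3 (2 * z) 0 ^ 2 := by
    field_simp
  rw [this]
  field_simp
  ring

theorem theta3_sq_eq (hz : 0 < z.im) :
    theta3 z 0 ^ 2 = (1 + modulus (2 * z)) * theta3 (2 * z) 0 ^ 2 := by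
  have h3 := theta3_ne_zero (im_two_mul_pos hz)
  rw [theta3_sq hz, modulus]
  field_simp

end Inversion

/-- By inversion 1 - m² is the square of the modulus at -1/(4z), which on the imaginary axis is
again a positive real. -/
theorem exists_modulus_lt_one {y : ℝ} (hy : 0 < y) :
    ∃ r : ℝ, 0 < r ∧ r < 1 ∧ modulus (I * y) = r := by
  have hz : 0 < (I * y : ℂ).im := by simpa using hy
  obtain ⟨r, hr, h⟩ := exists_modulus_eq_ofReal hy
  obtain ⟨s, hs, h'⟩ := exists_modulus_eq_ofReal (y := 1 / (4 * y)) (by positivity)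
  have e : (I * ((1 / (4 * y) : ℝ)) : ℂ) = -1 / (4 * (I * y)) := by
    have : (y : ℂ) ≠ 0 := ofReal_ne_zero.2 hy.ne'
    push_cast
    field_simp
    linear_combination I_sq
  rw [e, modulus_neg_inv hz] at h'
  have h1 := one_sub_modulus_sq hz
  rw [h, h'] at h1
  have h2 : 1 - r ^ 2 = s ^ 2 := by exact_mod_cast h1
  exact ⟨r, hr, by nlinarith [sq_pos_of_pos hs], h⟩

theorem I_mul_im_pos {y : ℝ} (hy : 0 < y) : 0 < (I * y : ℂ).im := by simpa using hy

/-- `₂F₁(1/2, 1/2; 1; m(q) ^ 2) = ϑ₃(q) ^ 2` for `0 < q < 1`. -/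
theorem hypergeometric_modulus {y : ℝ} (hy : 0 < y) :
    ordinaryHypergeometric (1 / 2 : ℂ) (1 / 2 : ℂ) (1 : ℂ) (modulus (I * y) ^ 2) =
      theta3 (I * y) 0 ^ 2 := by
  have hz := I_mul_im_pos hy
  set G : ℂ → ℂ := fun z =>
    ordinaryHypergeometric (1 / 2 : ℂ) (1 / 2 : ℂ) (1 : ℂ) (modulus z ^ 2) / theta3 z 0 ^ 2 with hG
  -- Going from 2z to z, Landen multiplies the numerator by 1 + m(2z), and `theta3_sq_eq` multiplies
  -- the denominator by the same factor.
  have step : ∀ y : ℝ, 0 < y → G (2 * (I * y)) = G (I * y) := fun y hy => by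
    have hz := I_mul_im_pos hy
    obtain ⟨r, hr, hr1, h⟩ := exists_modulus_lt_one (y := 2 * y) (by positivity)
    have e : (I * ((2 * y : ℝ) : ℂ)) = 2 * (I * y) := by push_cast; ring
    rw [e] at h
    have h1 : (1 + r : ℂ) ≠ 0 := by exact_mod_cast (by positivity : (1 + r : ℝ) ≠ 0)
    simp only [hG]
    rw [modulus_sq_eq hz, theta3_sq_eq hz, h, hypergeometric_landen hr.le hr1,
      mul_div_mul_left _ _ h1]
  have hconst : ∀ k : ℕ, G (2 ^ k * (I * y)) = G (I * y) := fun k => by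
    induction k with
    | zero => simp
    | succ k ih =>
      have h := step (2 ^ k * y) (by positivity)
      have e : I * ((2 ^ k * y : ℝ) : ℂ) = 2 ^ k * (I * y) := by push_cast; ring
      rw [e, ih] at h
      rw [← h, pow_succ']
      ring_nf
  have ht : Tendsto (fun k : ℕ => G (2 ^ k * (I * y))) atTop (𝓝 1) := by
    have h1 := (tendsto_modulus_two_pow hz).pow 2
    rw [zero_pow two_ne_zero] at h1
    have h2 := (continuousAt_hypergeometric_zero.tendsto.comp h1).div
      ((tendsto_theta3_two_pow hz).pow 2) (by simp)
    rwa [ordinaryHypergeometric_zero, one_pow, div_one] at h2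
  have h1 : G (I * y) = 1 :=
    tendsto_nhds_unique (tendsto_const_nhds.congr fun k => (hconst k).symm) ht
  exact (div_eq_one_iff_eq (pow_ne_zero 2 (theta3_ne_zero hz))).1 h1

theorem quarterAxis_eq {y : ℝ} (hy : 0 < y) :
    quarterAxis (I * y) = Real.pi / 2 * theta3 (I * y) 0 ^ 2 := by
  rw [quarterAxis, ellipticK, hypergeometric_modulus hy]

theorem compModulusAxis_eq {y : ℝ} (hy : 0 < y) :
    compModulusAxis (I * y) = modulus (-1 / (4 * (I * y))) := by
  have hz := I_mul_im_pos hy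
  have e : (-1 / (4 * (I * y)) : ℂ) = I * ((1 / (4 * y) : ℝ)) := by
    have : (y : ℂ) ≠ 0 := ofReal_ne_zero.2 hy.ne'
    push_cast
    field_simp
    linear_combination -I_sq
  rw [compModulusAxis, one_sub_modulus_sq hz, ← modulus_neg_inv hz, e]
  obtain ⟨r, hr, h⟩ := exists_modulus_eq_ofReal (y := 1 / (4 * y)) (by positivity)
  rw [h, ← ofReal_pow, show (1 / 2 : ℂ) = ((1 / 2 : ℝ) : ℂ) by push_cast; rfl,
    ← ofReal_cpow (by positivity), ← Real.sqrt_eq_rpow, Real.sqrt_sq hr.le]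

theorem quarterAxis'_eq {y : ℝ} (hy : 0 < y) :
    quarterAxis' (I * y) = -I * Real.pi * (I * y) * theta3 (I * y) 0 ^ 2 := by
  have hz := I_mul_im_pos hy
  have e : (-1 / (4 * (I * y)) : ℂ) = I * ((1 / (4 * y) : ℝ)) := by
    have : (y : ℂ) ≠ 0 := ofReal_ne_zero.2 hy.ne'
    push_cast
    field_simp
    linear_combination -I_sq
  rw [quarterAxis', ellipticK, compModulusAxis_eq hy, e, hypergeometric_modulus (by positivity),
    ← e, theta3_neg_inv hz]
  ring

theorem differentiableOn_theta3 : DifferentiableOn ℂ (fun z => theta3 z 0) upperHalf :=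
  fun z hz => by
    have h := (differentiableAt_jacobiTheta₂_snd 0 (im_two_mul_pos hz)).comp z
      (differentiableAt_id.const_mul (2 : ℂ))
    refine (h.congr_of_eventuallyEq (.of_forall fun w => ?_)).differentiableWithinAt
    simp [theta3_eq_jacobiTheta₂]

theorem differentiableOn_theta4 :
    DifferentiableOn ℂ (fun z => theta3 (z + 1 / 2) 0) upperHalf :=
  differentiableOn_theta3.comp (differentiableOn_id.add_const _) fun z hz => by
    simpa [upperHalf] using hz

theorem isContinuation_theta4_div_theta3 : IsContinuation compModulusAxis
    fun z => theta3 (z + 1 / 2) 0 ^ 2 / theta3 z 0 ^ 2 :=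
  ⟨(differentiableOn_theta4.pow 2).div (differentiableOn_theta3.pow 2)
    fun _ hz => pow_ne_zero 2 (theta3_ne_zero hz),
  fun y hy => by rw [compModulusAxis_eq hy, modulus_neg_inv (I_mul_im_pos hy)]⟩

theorem isContinuation_theta3_sq :
    IsContinuation quarterAxis fun z => Real.pi / 2 * theta3 z 0 ^ 2 :=
  ⟨(differentiableOn_theta3.pow 2).const_mul _, fun _ hy => (quarterAxis_eq hy).symm⟩

theorem isContinuation_mul_theta3_sq :
    IsContinuation quarterAxis' fun z => -I * Real.pi * z * theta3 z 0 ^ 2 :=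
  ⟨(differentiableOn_id.const_mul _).mul (differentiableOn_theta3.pow 2),
    fun _ hy => (quarterAxis'_eq hy).symm⟩

/-- The theta expression is holomorphic on the whole half plane, so it is the continuation; the same
argument serves K and K'. -/
theorem compModulus_eq {z : ℂ} (hz : 0 < z.im) :
    compModulus z = theta3 (z + 1 / 2) 0 ^ 2 / theta3 z 0 ^ 2 :=
  (isContinuation_continuation isContinuation_theta4_div_theta3).eqOn
    isContinuation_theta4_div_theta3 hz

theorem quarter_eq {z : ℂ} (hz : 0 < z.im) : quarter z = Real.pi / 2 * theta3 z 0 ^ 2 :=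
  (isContinuation_continuation isContinuation_theta3_sq).eqOn isContinuation_theta3_sq hz

theorem quarter'_eq {z : ℂ} (hz : 0 < z.im) :
    quarter' z = -I * Real.pi * z * theta3 z 0 ^ 2 :=
  (isContinuation_continuation isContinuation_mul_theta3_sq).eqOn isContinuation_mul_theta3_sq hz

/-! ### Partial fractions for ϑ₂/ϑ₃ by partial theta series. -/

/-- The general term `(-1) ^ n q ^ (n ^ 2 - n) X ^ (2 n)` of `ϑ₃`, with `X = e ^ ξ`. -/
noncomputable def theta3Exp (z ξ : ℂ) (n : ℤ) : ℂ :=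
  exp (Real.pi * I * n + 2 * Real.pi * I * z * (n ^ 2 - n) + 2 * n * ξ)

/-- The general term `(-1) ^ n q ^ (n ^ 2) X ^ (2 n + 1)` of `ϑ₂`, with `X = e ^ ξ`. -/
noncomputable def theta2Exp (z ξ : ℂ) (n : ℤ) : ℂ :=
  exp (Real.pi * I * n + 2 * Real.pi * I * z * n ^ 2 + (2 * n + 1) * ξ)

theorem theta3Exp_eq (z ξ : ℂ) (n : ℤ) :
    theta3Exp z ξ n = theta3Term z (-I * ξ - Real.pi * z - Real.pi / 2) n := by
  rw [theta3Exp, theta3Term, qpow, ← exp_add]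
  refine exp_eq_exp_of_int n ?_
  linear_combination (2 * n * ξ) * I_sq

theorem theta2Exp_eq (z ξ : ℂ) (n : ℤ) : theta2Exp z ξ n =
    I * qpow z (1 / 4) * theta2Term z (-I * ξ - Real.pi * z - Real.pi / 2) n := by
  have h : I = exp (Real.pi / 2 * I) := exp_pi_div_two_mul_I.symm
  rw [theta2Exp, theta2Term, qpow, qpow]
  nth_rw 3 [h]
  rw [← exp_add, ← exp_add, ← exp_add]
  refine exp_eq_exp_of_int n ?_
  linear_combination ((2 * n + 1) * ξ) * I_sq

theorem summable_theta2Exp {z : ℂ} (hz : 0 < z.im) (ξ : ℂ) : Summable (theta2Exp z ξ) := by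
  rw [funext (theta2Exp_eq z ξ)]
  exact (summable_theta2Term hz _).mul_left _

theorem tsum_theta3Exp (z ξ : ℂ) :
    ∑' n, theta3Exp z ξ n = theta3 z (-I * ξ - Real.pi * z - Real.pi / 2) := by
  rw [funext (theta3Exp_eq z ξ), theta3_eq_tsum]

theorem tsum_theta2Exp (z ξ : ℂ) : ∑' n, theta2Exp z ξ n =
    I * qpow z (1 / 4) * theta2 z (-I * ξ - Real.pi * z - Real.pi / 2) := by
  rw [funext (theta2Exp_eq z ξ), tsum_mul_left, theta2_eq_tsum]

/-- Quasi-periodicity under `X ↦ q ^ j X`. -/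
theorem tsum_theta3Exp_shift (z ξ : ℂ) (j : ℤ) :
    ∑' n, theta3Exp z (2 * Real.pi * I * z * j + ξ) n =
      exp (Real.pi * I * j + 2 * Real.pi * I * z * (j - j ^ 2) - 2 * j * ξ) *
        ∑' n, theta3Exp z ξ n := by
  rw [← tsum_mul_left, ← (Equiv.subRight j).tsum_eq]
  refine tsum_congr fun n => ?_
  rw [Equiv.subRight_apply, theta3Exp, theta3Exp, ← exp_add]
  refine exp_eq_exp_of_int (-j) ?_
  push_cast
  ring

/-- The tails `∑_{n ≥ N} (-1) ^ n q ^ (n ^ 2 + n)`. -/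
noncomputable def partialTheta (z : ℂ) (N : ℕ) : ℂ :=
  ∑' n : ℕ, exp (Real.pi * I * (n + N : ℕ)) * qpow z (((n + N) ^ 2 + (n + N) : ℕ) : ℝ)

theorem norm_qpow_nat (z : ℂ) (n : ℕ) :
    ‖qpow z ((n : ℝ) : ℂ)‖ = Real.exp (-(2 * Real.pi * z.im)) ^ n := by
  rw [norm_qpow, ← Real.exp_nat_mul]
  congr 1
  ring

theorem exp_neg_im_lt_one {z : ℂ} (hz : 0 < z.im) : Real.exp (-(2 * Real.pi * z.im)) < 1 := by
  rw [Real.exp_lt_one_iff, neg_lt_zero]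
  positivity

theorem norm_partialTheta_term_le {z : ℂ} (hz : 0 < z.im) (N n : ℕ) :
    ‖exp (Real.pi * I * (n + N : ℕ)) * qpow z (((n + N) ^ 2 + (n + N) : ℕ) : ℝ)‖ ≤
      Real.exp (-(2 * Real.pi * z.im)) ^ (N ^ 2 + N) * Real.exp (-(2 * Real.pi * z.im)) ^ n := by
  have := norm_exp_pi_mul_I_mul_int (n + N : ℕ)
  rw [Int.cast_natCast] at this
  rw [norm_mul, this, one_mul, norm_qpow_nat, ← pow_add]
  exact pow_le_pow_of_le_one (Real.exp_pos _).le (exp_neg_im_lt_one hz).le (by nlinarith)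

theorem summable_partialTheta {z : ℂ} (hz : 0 < z.im) (N : ℕ) : Summable fun n : ℕ =>
    exp (Real.pi * I * (n + N : ℕ)) * qpow z (((n + N) ^ 2 + (n + N) : ℕ) : ℝ) :=
  .of_norm_bounded ((summable_geometric_of_lt_one (Real.exp_pos _).le
    (exp_neg_im_lt_one hz)).mul_left _) (norm_partialTheta_term_le hz N)

theorem norm_partialTheta_le {z : ℂ} (hz : 0 < z.im) (N : ℕ) :
    ‖partialTheta z N‖ ≤ (1 - Real.exp (-(2 * Real.pi * z.im)))⁻¹ *
      Real.exp (-(2 * Real.pi * z.im)) ^ (N ^ 2 + N) := by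
  have h := (hasSum_geometric_of_lt_one (Real.exp_pos _).le (exp_neg_im_lt_one hz)).mul_left
    (Real.exp (-(2 * Real.pi * z.im)) ^ (N ^ 2 + N))
  rw [mul_comm]
  exact tsum_of_norm_bounded h (norm_partialTheta_term_le hz N)

theorem partialTheta_eq {z : ℂ} (hz : 0 < z.im) (N : ℕ) : partialTheta z N =
    exp (Real.pi * I * N) * qpow z (N ^ 2 + N) + partialTheta z (N + 1) := by
  rw [partialTheta, (summable_partialTheta hz N).tsum_eq_zero_add, partialTheta]
  congr 1
  · simp
  · refine tsum_congr fun n => ?_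
    rw [show n + 1 + N = n + (N + 1) by ring]

/-- The substitution n ↦ -1 - n fixes n² + n and reverses (-1)^n, so a tail starting at a negative
index agrees with one starting at its absolute value. Thus d_k = `partialTheta z k.natAbs`
telescopes over all integers, and its differences are the coefficients of ϑ₃ in X². -/
theorem partialTheta_sub {z : ℂ} (hz : 0 < z.im) (k : ℤ) :
    partialTheta z k.natAbs - partialTheta z (k - 1).natAbs =
      exp (Real.pi * I * k + 2 * Real.pi * I * z * (k ^ 2 - k)) := by
  rcases le_or_gt k 0 with h | h
  · obtain ⟨N, rfl⟩ : ∃ N : ℕ, k = -N := ⟨k.natAbs, by omega⟩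
    rw [show (-(N : ℤ)).natAbs = N by omega, show (-(N : ℤ) - 1).natAbs = N + 1 by omega,
      partialTheta_eq hz N, add_sub_cancel_right, qpow, ← exp_add]
    refine exp_eq_exp_of_int N ?_
    push_cast
    ring
  · obtain ⟨N, rfl⟩ : ∃ N : ℕ, k = N + 1 := ⟨k.natAbs - 1, by omega⟩
    rw [show ((N : ℤ) + 1).natAbs = N + 1 by omega, show ((N : ℤ) + 1 - 1).natAbs = N by omega,
      partialTheta_eq hz N, sub_add_cancel_right, qpow, ← exp_add, ← neg_one_mul, ← exp_pi_mul_I,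
      ← exp_add]
    congr 1
    push_cast
    ring

theorem summable_partialTheta_mul_exp {z : ℂ} (hz : 0 < z.im) (ξ : ℂ) :
    Summable fun k : ℤ => partialTheta z k.natAbs * exp (2 * k * ξ) := by
  refine .of_norm_bounded (((summable_theta3Term hz (-I * ξ)).norm).mul_left
    (1 - Real.exp (-(2 * Real.pi * z.im)))⁻¹) fun k => ?_
  have h1 : (1 - Real.exp (-(2 * Real.pi * z.im)))⁻¹ ≥ 0 :=
    inv_nonneg.2 (sub_nonneg.2 (exp_neg_im_lt_one hz).le)
  have e1 : qpow z ((k : ℂ) ^ 2) = qpow z (((k.natAbs ^ 2 : ℕ) : ℝ) : ℂ) := by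
    have : (k.natAbs : ℤ) ^ 2 = k ^ 2 := Int.natAbs_sq k
    have : ((k.natAbs : ℤ) : ℂ) ^ 2 = (k : ℂ) ^ 2 := by exact_mod_cast this
    rw [Int.cast_natCast] at this
    rw [← this, Nat.cast_pow, ofReal_pow, ofReal_natCast]
  have e2 : (2 * k * I * (-I * ξ) : ℂ) = 2 * k * ξ := by linear_combination (-2 * k * ξ) * I_sq
  rw [norm_mul, theta3Term, e2, norm_mul, ← mul_assoc, e1, norm_qpow_nat]
  refine mul_le_mul_of_nonneg_right ((norm_partialTheta_le hz _).trans ?_) (norm_nonneg _)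
  exact mul_le_mul_of_nonneg_left (pow_le_pow_of_le_one (Real.exp_pos _).le
    (exp_neg_im_lt_one hz).le (by omega)) h1

/-- `ϑ₃` divided by `1 - X ^ 2`. -/
theorem tsum_theta3Exp_eq {z : ℂ} (hz : 0 < z.im) (ξ : ℂ) : ∑' n, theta3Exp z ξ n =
    (1 - exp (2 * ξ)) * ∑' k : ℤ, partialTheta z k.natAbs * exp (2 * k * ξ) := by
  have hs := summable_partialTheta_mul_exp hz ξ
  have hs' : Summable fun k : ℤ => partialTheta z (k - 1).natAbs * exp (2 * k * ξ) := by
    refine (((Equiv.subRight (1 : ℤ)).summable_iff.2 hs).mul_left (exp (2 * ξ))).congr fun k => ?_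
    rw [Function.comp_apply, Equiv.subRight_apply, mul_left_comm, ← exp_add]
    congr 2
    push_cast
    ring
  have h : ∑' k : ℤ, partialTheta z (k - 1).natAbs * exp (2 * k * ξ) =
      exp (2 * ξ) * ∑' k : ℤ, partialTheta z k.natAbs * exp (2 * k * ξ) := by
    rw [← tsum_mul_left, ← (Equiv.subRight (1 : ℤ)).tsum_eq
      fun k : ℤ => exp (2 * ξ) * (partialTheta z k.natAbs * exp (2 * k * ξ))]
    refine tsum_congr fun k => ?_
    rw [Equiv.subRight_apply, mul_left_comm, ← exp_add]
    congr 2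
    push_cast
    ring
  -- Multiplication by 1 - X² takes first differences of the coefficients, which are those of ϑ₃ by
  -- `partialTheta_sub`.
  rw [sub_mul, one_mul, ← h, ← hs.tsum_sub hs']
  refine tsum_congr fun k => ?_
  rw [← sub_mul, partialTheta_sub hz, theta3Exp, ← exp_add]

/-- The constant `∑ (-1) ^ k q ^ (-k ^ 2) d_k` in the partial fraction expansion. -/
noncomputable def heckeSum (z : ℂ) : ℂ :=
  ∑' k : ℤ, exp (Real.pi * I * k - 2 * Real.pi * I * z * k ^ 2) * partialTheta z k.natAbs

/-- The growth of q^{-k²} is compensated by d_k = O(r^{k² + |k|}) with r = |q|, leaving a geometric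
series in |k|. -/
theorem summable_heckeSum {z : ℂ} (hz : 0 < z.im) : Summable fun k : ℤ =>
    exp (Real.pi * I * k - 2 * Real.pi * I * z * k ^ 2) * partialTheta z k.natAbs := by
  have hr := summable_geometric_of_lt_one (Real.exp_pos _).le (exp_neg_im_lt_one hz)
  have hr' : Summable fun k : ℤ => Real.exp (-(2 * Real.pi * z.im)) ^ k.natAbs :=
    .of_nat_of_neg (by simpa using hr) (by simpa using hr)
  refine .of_norm_bounded (hr'.mul_left (1 - Real.exp (-(2 * Real.pi * z.im)))⁻¹) fun k => ?_
  have e : exp (Real.pi * I * k - 2 * Real.pi * I * z * k ^ 2) * qpow z ((k.natAbs ^ 2 : ℕ) : ℝ) =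
      exp (Real.pi * I * k) := by
    have : (k.natAbs : ℤ) ^ 2 = k ^ 2 := Int.natAbs_sq k
    have : ((k.natAbs : ℤ) : ℂ) ^ 2 = (k : ℂ) ^ 2 := by exact_mod_cast this
    rw [Int.cast_natCast] at this
    rw [qpow, ← exp_add]
    congr 1
    push_cast
    rw [this]
    ring
  have e' := congrArg norm e
  rw [norm_mul, norm_exp_pi_mul_I_mul_int, norm_qpow_nat] at e'
  rw [norm_mul]
  calc _ ≤ ‖exp (Real.pi * I * k - 2 * Real.pi * I * z * k ^ 2)‖ *
        ((1 - Real.exp (-(2 * Real.pi * z.im)))⁻¹ *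
          Real.exp (-(2 * Real.pi * z.im)) ^ (k.natAbs ^ 2 + k.natAbs)) := by
        gcongr
        exact norm_partialTheta_le hz _
    _ = _ := by
        rw [pow_add]
        linear_combination ((1 - Real.exp (-(2 * Real.pi * z.im)))⁻¹ *
          Real.exp (-(2 * Real.pi * z.im)) ^ k.natAbs) * e'

/-- The shear `(j, k) ↦ (j + k, k)` of the lattice. -/
def shearEquiv : ℤ × ℤ ≃ ℤ × ℤ where
  toFun p := (p.1 + p.2, p.2)
  invFun p := (p.1 - p.2, p.2)
  left_inv p := by simp
  right_inv p := by simp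

/-- Partial fraction expansion of a quotient of theta functions, up to a constant. -/
theorem hasSum_partialFraction {z : ℂ} (hz : 0 < z.im) {ξ : ℂ}
    (hξ : ∀ j : ℤ, exp (2 * (2 * Real.pi * I * z * j + ξ)) ≠ 1) :
    HasSum (fun j : ℤ => exp (2 * Real.pi * I * z * j + ξ) /
        (1 - exp (2 * (2 * Real.pi * I * z * j + ξ))) * ∑' n, theta3Exp z ξ n)
      ((∑' n, theta2Exp z ξ n) * heckeSum z) := by
  -- The product is a double series over (n, k). With n = j + k the quadratic terms in k cancel,
  -- since (j + k)² - k² = j² + 2jk. For fixed j the sum over k is then Σ d_k (q^j X)^{2k}, that is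
  -- ϑ₃ at q^j X divided by 1 - (q^j X)², and quasi-periodicity brings ϑ₃ back to X.
  have h := hasSum_mul_hasSum (summable_theta2Exp hz ξ).hasSum (summable_heckeSum hz).hasSum
  rw [← shearEquiv.hasSum_iff] at h
  refine h.prod_fiberwise fun j => ?_
  have hj := (summable_partialTheta_mul_exp hz (2 * Real.pi * I * z * j + ξ)).hasSum.mul_left
    (exp (Real.pi * I * j + 2 * Real.pi * I * z * j ^ 2 + (2 * j + 1) * ξ))
  have e1 : ∑' k : ℤ, partialTheta z k.natAbs * exp (2 * k * (2 * Real.pi * I * z * j + ξ)) =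
      (∑' n, theta3Exp z (2 * Real.pi * I * z * j + ξ) n) /
        (1 - exp (2 * (2 * Real.pi * I * z * j + ξ))) := by
    rw [tsum_theta3Exp_eq hz, mul_div_cancel_left₀ _ (sub_ne_zero.2 (hξ j).symm)]
  have e2 : exp (Real.pi * I * j + 2 * Real.pi * I * z * j ^ 2 + (2 * j + 1) * ξ) *
      exp (Real.pi * I * j + 2 * Real.pi * I * z * (j - j ^ 2) - 2 * j * ξ) =
      exp (2 * Real.pi * I * z * j + ξ) := by
    rw [← exp_add]
    refine exp_eq_exp_of_int j ?_
    ring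
  rw [e1, tsum_theta3Exp_shift, ← mul_div_assoc, ← mul_assoc, e2, mul_div_right_comm] at hj
  have e3 : ∀ k : ℤ, exp (Real.pi * I * j + 2 * Real.pi * I * z * j ^ 2 + (2 * j + 1) * ξ) *
      (partialTheta z k.natAbs * exp (2 * k * (2 * Real.pi * I * z * j + ξ))) =
      theta2Exp z ξ (j + k) *
        (exp (Real.pi * I * k - 2 * Real.pi * I * z * k ^ 2) * partialTheta z k.natAbs) :=
    fun k => by
      rw [theta2Exp, mul_left_comm, mul_comm (partialTheta _ _), ← mul_assoc, ← exp_add, ← exp_add]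
      congr 1
      refine exp_eq_exp_of_int (-k) ?_
      push_cast
      ring
  simp_rw [e3] at hj
  exact hj

/-! ### Evaluation of the constant in the partial fractions. -/

theorem hasSum_of_eq {ι : Type*} {f g : ι → ℂ} {a b : ℂ} (h : HasSum f a) (hfg : ∀ i, g i = f i)
    (hab : b = a) : HasSum g b := by
  rwa [funext hfg, hab]

theorem hasSum_int_even_add_odd {f : ℤ → ℂ} {a b : ℂ} (he : HasSum (fun k => f (2 * k)) a)
    (ho : HasSum (fun k => f (2 * k + 1)) b) : HasSum f (a + b) := by
  have h2 : Function.Injective fun k : ℤ => 2 * k := fun _ _ h => by simpa using h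
  have h2' : Function.Injective fun k : ℤ => 2 * k + 1 := fun _ _ h => by simpa using h
  refine (h2.hasSum_range_iff.2 he).add_isCompl ?_ (h2'.hasSum_range_iff.2 ho)
  simpa [Function.comp_def] using Int.isCompl_even_odd

theorem theta3_neg_pi_mul (z : ℂ) :
    qpow z (1 / 4) * theta3 z (-(Real.pi * z)) = theta2 z 0 := by
  rw [theta3_eq_tsum, theta2_eq_tsum, ← tsum_mul_left, ← (Equiv.addRight (1 : ℤ)).tsum_eq]
  refine tsum_congr fun n => ?_
  simp only [theta3Term, theta2Term, qpow, ← exp_add, Equiv.coe_addRight]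
  congr 1
  push_cast
  ring

theorem theta2_neg_pi_mul (z : ℂ) :
    qpow z (1 / 4) * theta2 z (-(Real.pi * z)) = theta3 z 0 := by
  rw [theta3_eq_tsum, theta2_eq_tsum, ← tsum_mul_left]
  refine tsum_congr fun n => ?_
  simp only [theta3Term, theta2Term, qpow, ← exp_add]
  congr 1
  ring

theorem norm_qpow_lt_one {z : ℂ} (hz : 0 < z.im) {s : ℝ} (hs : 0 < s) : ‖qpow z s‖ < 1 := by
  rw [norm_qpow, Real.exp_lt_one_iff, neg_lt_zero]
  positivity

theorem qpow_ofReal_norm_eq_one_iff {z : ℂ} (hz : 0 < z.im) (s : ℝ) :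
    ‖qpow z s‖ = 1 ↔ s = 0 := by
  rw [norm_qpow, Real.exp_eq_one_iff]
  have := Real.pi_pos.ne'
  simp [hz.ne', this]

theorem one_add_qpow_ne_zero {z : ℂ} (hz : 0 < z.im) (s : ℝ) : 1 + qpow z s ≠ 0 := fun h => by
  have h' : qpow z s = -1 := by linear_combination h
  have h0 : s = 0 := (qpow_ofReal_norm_eq_one_iff hz s).1 (by rw [h', norm_neg, norm_one])
  rw [h0, ofReal_zero, qpow_zero] at h
  norm_num at h

theorem one_sub_qpow_ne_zero {z : ℂ} (hz : 0 < z.im) {s : ℝ} (hs : s ≠ 0) :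
    1 - qpow z s ≠ 0 := fun h => by
  have h' : qpow z s = 1 := by linear_combination -h
  exact hs ((qpow_ofReal_norm_eq_one_iff hz s).1 (by rw [h', norm_one]))

/-- `∑ q ^ (j + σ) / (1 + q ^ (2 j + 2 σ))`, up to theta factors. -/
theorem hasSum_qpow_div_one_add {z : ℂ} (hz : 0 < z.im) (σ : ℝ) :
    HasSum (fun j : ℤ => I * (qpow z ((j + σ : ℝ) : ℂ) / (1 + qpow z ((2 * (j + σ) : ℝ) : ℂ))) *
        theta3 z ((2 * σ - 1) * Real.pi * z))
      (I * qpow z (1 / 4) * theta2 z ((2 * σ - 1) * Real.pi * z) * heckeSum z) := by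
  -- X = i q^σ, so that 1 - (q^j X)² becomes 1 + q^{2j+2σ}, which never vanishes.
  set ξ : ℂ := Real.pi / 2 * I + 2 * Real.pi * I * σ * z with hξ
  have e1 : ∀ j : ℤ, exp (2 * Real.pi * I * z * j + ξ) = I * qpow z ((j + σ : ℝ) : ℂ) := fun j => by
    have h := exp_pi_div_two_mul_I
    have h' : I * qpow z ((j + σ : ℝ) : ℂ) = exp (Real.pi / 2 * I) * qpow z ((j + σ : ℝ) : ℂ) := by
      rw [h]
    rw [h', qpow, ← exp_add]
    congr 1
    push_cast
    rw [hξ]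
    ring
  have e2 : ∀ j : ℤ, exp (2 * (2 * Real.pi * I * z * j + ξ)) =
      -qpow z ((2 * (j + σ) : ℝ) : ℂ) := fun j => by
    have : exp (2 * (2 * Real.pi * I * z * j + ξ)) = exp (2 * Real.pi * I * z * j + ξ) ^ 2 := by
      rw [← exp_nat_mul]
      rfl
    rw [this, e1, mul_pow, I_sq, neg_one_mul, sq, ← qpow_add]
    congr 2
    push_cast
    ring
  have e3 : -I * ξ - Real.pi * z - Real.pi / 2 = (2 * σ - 1) * Real.pi * z := by
    rw [hξ]
    linear_combination (-(Real.pi / 2) - 2 * Real.pi * σ * z) * I_sq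
  have h := hasSum_partialFraction hz (ξ := ξ) fun j h => by
    rw [e2] at h
    exact one_add_qpow_ne_zero hz _ (by rw [← h]; ring : 1 + qpow z ((2 * (j + σ) : ℝ) : ℂ) = 0)
  rw [tsum_theta3Exp, tsum_theta2Exp, e3] at h
  simp_rw [e1, e2, sub_neg_eq_add, mul_div_assoc] at h
  exact h

theorem hasSum_two_mul_qpow_div {z : ℂ} (hz : 0 < z.im) :
    HasSum (fun j : ℤ => 2 * (qpow z ((j : ℝ) : ℂ) / (1 + qpow z ((2 * j : ℝ) : ℂ))))
      (2 * qpow z (1 / 4) * heckeSum z * theta3 z 0 / theta2 z 0) := by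
  have h := hasSum_qpow_div_one_add hz 0
  have e : ((2 * (0 : ℝ) - 1 : ℂ) * Real.pi * z) = -(Real.pi * z) := by push_cast; ring
  simp only [add_zero] at h
  rw [e] at h
  have h2 := theta2_ne_zero hz
  have e3 := theta3_neg_pi_mul z
  have e2 := theta2_neg_pi_mul z
  have hq := qpow_ne_zero z (1 / 4)
  have h3 : theta3 z (-(Real.pi * z)) = theta2 z 0 / qpow z (1 / 4) := by
    rw [← e3]
    field_simp
  refine hasSum_of_eq (h.mul_left (2 * qpow z (1 / 4) / (I * theta2 z 0))) (fun j => ?_) ?_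
  · rw [h3]
    field_simp
  · rw [← e2]
    field_simp

theorem hasSum_two_mul_qpow_div_half {z : ℂ} (hz : 0 < z.im) :
    HasSum (fun j : ℤ => 2 * (qpow z ((j + 1 / 2 : ℝ) : ℂ) /
        (1 + qpow z ((2 * (j + 1 / 2) : ℝ) : ℂ))))
      (2 * qpow z (1 / 4) * heckeSum z * theta2 z 0 / theta3 z 0) := by
  have h := hasSum_qpow_div_one_add hz (1 / 2)
  have e : ((2 * ((1 / 2 : ℝ) : ℂ) - 1 : ℂ) * Real.pi * z) = 0 := by push_cast; ring
  rw [e] at h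
  have h3 := theta3_ne_zero hz
  refine hasSum_of_eq (h.mul_left (2 / (I * theta3 z 0))) (fun j => ?_) ?_
  · generalize qpow z ((j + 1 / 2 : ℝ) : ℂ) / _ = t
    field_simp
  · field_simp

/-- The left side is the sum of 2q^j/(1 + q^{2j}). Its even and odd terms are the series for σ = 0
and σ = 1/2 in the nome q², and the second sum is m(2z) times the first. -/
theorem heckeSum_doubling {z : ℂ} (hz : 0 < z.im) :
    2 * qpow z (1 / 4) * heckeSum z * theta3 z 0 / theta2 z 0 = (1 + modulus (2 * z)) *
      (2 * qpow (2 * z) (1 / 4) * heckeSum (2 * z) * theta3 (2 * z) 0 / theta2 (2 * z) 0) := by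
  have hz2 := im_two_mul_pos hz
  have h0 := hasSum_two_mul_qpow_div hz2
  have h1 := hasSum_two_mul_qpow_div_half hz2
  have h2 := theta2_ne_zero hz2
  have h3 := theta3_ne_zero hz2
  have hdouble : ∀ s : ℝ, qpow (2 * z) s = qpow z ((2 * s : ℝ) : ℂ) := fun s => by
    rw [qpow, qpow]
    congr 1
    push_cast
    ring
  simp_rw [hdouble] at h0 h1
  have h := hasSum_int_even_add_odd (f := fun j : ℤ =>
    2 * (qpow z ((j : ℝ) : ℂ) / (1 + qpow z ((2 * j : ℝ) : ℂ)))) (by simpa using h0) (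
      hasSum_of_eq h1 (fun j => by push_cast; ring_nf) rfl)
  rw [(hasSum_two_mul_qpow_div hz).unique h, modulus]
  field_simp

/-- The term is invariant under q^j ↦ q^{-j}. Using |j| avoids unbounded powers when the nome tends
to 0. -/
theorem heckeSum_series_eq_natAbs {z : ℂ} (j : ℤ) :
    qpow z ((j : ℝ) : ℂ) / (1 + qpow z ((2 * j : ℝ) : ℂ)) =
      qpow z ((j.natAbs : ℝ) : ℂ) / (1 + qpow z ((2 * j.natAbs : ℝ) : ℂ)) := by
  have key : ∀ s : ℝ, qpow z ((-s : ℝ) : ℂ) / (1 + qpow z ((2 * (-s) : ℝ) : ℂ)) =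
      qpow z (s : ℂ) / (1 + qpow z ((2 * s : ℝ) : ℂ)) := fun s => by
    have h : qpow z ((2 * (-s) : ℝ) : ℂ) * qpow z ((2 * s : ℝ) : ℂ) = 1 := by
      rw [← qpow_add, ← qpow_zero z]
      congr 1
      push_cast
      ring
    have h' : qpow z ((-s : ℝ) : ℂ) * qpow z ((2 * s : ℝ) : ℂ) = qpow z (s : ℂ) := by
      rw [← qpow_add]
      congr 1
      push_cast
      ring
    rw [← mul_div_mul_right _ _ (qpow_ne_zero z ((2 * s : ℝ) : ℂ)), h', add_mul, one_mul, h,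
      add_comm]
  rcases Int.natAbs_eq j with h | h
  · nth_rw 1 2 [h]
    simp
  · have := key (j.natAbs : ℝ)
    rw [← this]
    have e : (j : ℝ) = -(j.natAbs : ℝ) := by
      nth_rw 1 [h]
      simp
    rw [e]

/-- `2 ∑ q ^ j / (1 + q ^ (2 j)) → 1` as the nome is squared again and again. -/
theorem tendsto_two_mul_qpow_div {z : ℂ} (hz : 0 < z.im) :
    Tendsto (fun k : ℕ => ∑' j : ℤ, 2 * (qpow (2 ^ k * z) ((j : ℝ) : ℂ) /
      (1 + qpow (2 ^ k * z) ((2 * j : ℝ) : ℂ)))) atTop (𝓝 1) := by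
  set r := Real.exp (-(2 * Real.pi * z.im)) with hr
  have hr0 : 0 < r := Real.exp_pos _
  have hr1 : r < 1 := exp_neg_im_lt_one hz
  have hg := summable_geometric_of_lt_one hr0.le hr1
  have hs : Summable fun j : ℤ => r ^ j.natAbs :=
    .of_nat_of_neg (by simpa using hg) (by simpa using hg)
  have hl : (1 : ℂ) = ∑' j : ℤ, if j = 0 then (1 : ℂ) else 0 :=
    (tsum_ite_eq (0 : ℤ) fun _ => (1 : ℂ)).symm
  suffices hd : Tendsto (fun k : ℕ => ∑' j : ℤ, 2 * (qpow (2 ^ k * z) ((j : ℝ) : ℂ) /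
      (1 + qpow (2 ^ k * z) ((2 * j : ℝ) : ℂ)))) atTop
      (𝓝 (∑' j : ℤ, if j = 0 then (1 : ℂ) else 0)) by
    rwa [← hl] at hd
  refine tendsto_tsum_of_dominated_convergence (hs.mul_left (2 * (1 - r)⁻¹)) (fun j => ?_)
    (.of_forall fun k j => ?_)
  · simp_rw [heckeSum_series_eq_natAbs j]
    split_ifs with h
    · simp [h, qpow_zero]
      norm_num
    · have hj : (0 : ℝ) < j.natAbs := by
        have := Int.natAbs_pos.2 h
        exact_mod_cast this
      have t1 := tendsto_qpow_two_pow hz hj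
      have t2 := (tendsto_qpow_two_pow hz (s := 2 * j.natAbs) (by positivity)).const_add 1
      simpa using (t1.div t2 (by simp)).const_mul 2
  · rw [heckeSum_series_eq_natAbs j, norm_mul, norm_div, Complex.norm_ofNat, mul_assoc]
    have hk := im_two_pow_mul_pos hz k
    have n1 := norm_qpow_two_pow_le hz (s := j.natAbs) (by positivity) k
    have n0 := norm_qpow_nat z j.natAbs
    rw [n0, ← hr] at n1
    refine mul_le_mul_of_nonneg_left ?_ zero_le_two
    rcases Nat.eq_zero_or_pos j.natAbs with h | h
    · simp only [h, Nat.cast_zero, mul_zero, ofReal_zero, qpow_zero, norm_one, pow_zero, mul_one]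
      have : (1 : ℝ) ≤ (1 - r)⁻¹ := (one_le_inv₀ (by linarith)).2 (by linarith)
      refine le_trans ?_ this
      norm_num
    · have n2 := norm_qpow_two_pow_le hz (s := (2 * j.natAbs : ℕ)) (by positivity) k
      rw [norm_qpow_nat z, ← hr] at n2
      have n3 : r ^ (2 * j.natAbs) ≤ r := pow_le_of_le_one hr0.le hr1.le (by omega)
      have n4 : 1 - r ≤ ‖1 + qpow (2 ^ k * z) ((2 * j.natAbs : ℝ) : ℂ)‖ := by
        have := norm_sub_norm_le (1 : ℂ) (-qpow (2 ^ k * z) ((2 * j.natAbs : ℝ) : ℂ))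
        rw [norm_neg, norm_one, sub_neg_eq_add] at this
        push_cast at n2 this ⊢
        linarith
      rw [div_eq_mul_inv, mul_comm]
      have : 0 < 1 - r := by linarith
      gcongr

/-- `2 q ^ (1/4) ∑ (-1) ^ k q ^ (-k ^ 2) d_k = ϑ₂ ϑ₃`. -/
theorem heckeSum_eq {z : ℂ} (hz : 0 < z.im) :
    2 * qpow z (1 / 4) * heckeSum z = theta2 z 0 * theta3 z 0 := by
  -- f is the sum of 2q^j/(1 + q^{2j}). Both f and ϑ₃² acquire the factor 1 + m(2z) in passing from
  -- 2z to z, so their ratio R is invariant under doubling, and its limit is 1.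
  set f : ℂ → ℂ := fun z => 2 * qpow z (1 / 4) * heckeSum z * theta3 z 0 / theta2 z 0 with hf
  set R : ℂ → ℂ := fun z => f z / theta3 z 0 ^ 2 with hR
  have hstep : ∀ w : ℂ, 0 < w.im → R w = R z → R (2 * w) = R z := fun w hw h => by
    rw [← h]
    have hm : 1 + modulus (2 * w) ≠ 0 := fun h0 => by
      have := theta3_sq_eq hw
      rw [h0, zero_mul] at this
      exact pow_ne_zero 2 (theta3_ne_zero hw) this
    simp only [hR, hf]
    rw [heckeSum_doubling hw, theta3_sq_eq hw, mul_div_mul_left _ _ hm]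
  have hconst := eventually_of_doubling hstep hz rfl
  have ht : Tendsto (fun k : ℕ => R (2 ^ k * z)) atTop (𝓝 1) := by
    have h1 := (tendsto_two_mul_qpow_div hz).div ((tendsto_theta3_two_pow hz).pow 2) (by simp)
    rw [one_pow, div_one] at h1
    refine h1.congr fun k => ?_
    simp only [Pi.div_apply, hR, hf]
    rw [(hasSum_two_mul_qpow_div (im_two_pow_mul_pos hz k)).tsum_eq]
  have h1 : R z = 1 := tendsto_nhds_unique (tendsto_const_nhds.congr fun k => (hconst k).symm) ht
  have h2 := theta2_ne_zero hz
  have h3 := theta3_ne_zero hz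
  simp only [hR, hf] at h1
  field_simp at h1
  linear_combination h1

/-! ### The odd Lambert series and the value of ϑ₂/ϑ₃ at v. -/

theorem qpow_nat_mul (z s : ℂ) (n : ℕ) : qpow z (n * s) = qpow z s ^ n := by
  rw [qpow, qpow, ← exp_nat_mul]
  congr 1
  ring

/-- The Lambert series `∑ q ^ ((2 n + 1) s) / (1 - q ^ (2 n + 1))`. -/
noncomputable def oddLambert (z : ℂ) (s : ℝ) : ℂ :=
  ∑' p : ℕ × ℕ, qpow z (((2 * p.1 + 1) * (p.2 + s) : ℝ) : ℂ)

theorem summable_oddLambert {z : ℂ} (hz : 0 < z.im) {s : ℝ} (hs : 0 < s) :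
    Summable fun p : ℕ × ℕ => qpow z (((2 * p.1 + 1) * (p.2 + s) : ℝ) : ℂ) := by
  have h1 := summable_geometric_of_lt_one (norm_nonneg _) (norm_qpow_lt_one hz hs)
  have h2 := summable_geometric_of_lt_one (norm_nonneg _) (norm_qpow_lt_one hz one_pos)
  refine .of_norm_bounded
    (h1.mul_of_nonneg h2 (fun _ => by positivity) (fun _ => by positivity)) fun p => ?_
  simp only [norm_qpow, ← Real.exp_nat_mul, ← Real.exp_add]
  rw [Real.exp_le_exp]
  have e : 0 ≤ 2 * Real.pi * z.im * ((p.1 + 1) * s + 2 * p.1 * p.2) := by positivity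
  linarith

theorem hasSum_oddLambert {z : ℂ} (hz : 0 < z.im) {s : ℝ} (hs : 0 < s) :
    HasSum (fun n : ℕ => qpow z (((2 * n + 1) * s : ℝ) : ℂ) / (1 - qpow z ((2 * n + 1 : ℝ) : ℂ)))
      (oddLambert z s) := by
  refine (summable_oddLambert hz hs).hasSum.prod_fiberwise fun n => ?_
  have h := (hasSum_geometric_of_norm_lt_one
    (norm_qpow_lt_one hz (s := 2 * n + 1) (by positivity))).mul_left
      (qpow z (((2 * n + 1) * s : ℝ) : ℂ))
  refine hasSum_of_eq h (fun j => ?_) (div_eq_mul_inv _ _)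
  rw [← qpow_nat_mul, ← qpow_add]
  congr 1
  push_cast
  ring

/-- The other order of summation in the same double series. This form occurs in the partial
fractions and in θ', the row form in cd₁ and ss. -/
theorem hasSum_oddLambert' {z : ℂ} (hz : 0 < z.im) {s : ℝ} (hs : 0 < s) :
    HasSum (fun j : ℕ => qpow z ((j + s : ℝ) : ℂ) / (1 - qpow z ((2 * (j + s) : ℝ) : ℂ)))
      (oddLambert z s) := by
  have h := (Equiv.prodComm ℕ ℕ).hasSum_iff.2 (summable_oddLambert hz hs).hasSum
  refine h.prod_fiberwise fun j => ?_
  have h := (hasSum_geometric_of_norm_lt_one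
    (norm_qpow_lt_one hz (s := 2 * (j + s)) (by positivity))).mul_left (qpow z ((j + s : ℝ) : ℂ))
  refine hasSum_of_eq h (fun n => ?_) (div_eq_mul_inv _ _)
  rw [← qpow_nat_mul, ← qpow_add]
  simp only [Function.comp_apply, Equiv.prodComm_apply, Prod.fst_swap, Prod.snd_swap]
  congr 1
  push_cast
  ring

theorem qpow_div_one_sub_neg (z : ℂ) (s : ℝ) :
    qpow z ((-s : ℝ) : ℂ) / (1 - qpow z ((2 * (-s) : ℝ) : ℂ)) =
      -(qpow z (s : ℂ) / (1 - qpow z ((2 * s : ℝ) : ℂ))) := by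
  have h : qpow z ((2 * (-s) : ℝ) : ℂ) * qpow z ((2 * s : ℝ) : ℂ) = 1 := by
    rw [← qpow_add, ← qpow_zero z]
    congr 1
    push_cast
    ring
  have h' : qpow z ((-s : ℝ) : ℂ) * qpow z ((2 * s : ℝ) : ℂ) = qpow z (s : ℂ) := by
    rw [← qpow_add]
    congr 1
    push_cast
    ring
  rw [← mul_div_mul_right _ _ (qpow_ne_zero z ((2 * s : ℝ) : ℂ)), h', sub_mul, one_mul, h,
    ← neg_sub, div_neg]

/-- The quotient `ϑ₂(v) / ϑ₃(v)` at `e ^ (2 i v) = -q ^ (2 a - 1)`. -/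
theorem theta2_div_theta3_shift {z : ℂ} (hz : 0 < z.im) {a : ℝ} (h0 : 0 < a) (h1 : a < 1) :
    theta2 z 0 * theta3 z 0 * (theta2 z (-(Real.pi / 2) + (2 * a - 1) * Real.pi * z) /
      theta3 z (-(Real.pi / 2) + (2 * a - 1) * Real.pi * z)) =
      -2 * I * (oddLambert z a - oddLambert z (1 - a)) := by
  have hne := theta3_shift_ne_zero hz h0 h1
  -- X = q^a; as 0 < a < 1, no q^{j+a} meets a pole.
  set ξ : ℂ := 2 * Real.pi * I * z * a with hξ
  have e1 : ∀ j : ℤ, exp (2 * Real.pi * I * z * j + ξ) = qpow z ((j + a : ℝ) : ℂ) := fun j => by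
    rw [qpow]
    congr 1
    push_cast
    rw [hξ]
    ring
  have e2 : ∀ j : ℤ, exp (2 * (2 * Real.pi * I * z * j + ξ)) =
      qpow z ((2 * (j + a) : ℝ) : ℂ) := fun j => by
    rw [qpow]
    congr 1
    push_cast
    rw [hξ]
    ring
  have e3 : -I * ξ - Real.pi * z - Real.pi / 2 = -(Real.pi / 2) + (2 * a - 1) * Real.pi * z := by
    rw [hξ]
    linear_combination (-(2 * Real.pi * z * a)) * I_sq
  have hja : ∀ j : ℤ, (j + a : ℝ) ≠ 0 := fun j h => by
    have l1 : (-1 : ℝ) < j := by linarith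
    have l2 : (j : ℝ) < 0 := by linarith
    have l1' : (-1 : ℤ) < j := by exact_mod_cast l1
    have l2' : j < 0 := by exact_mod_cast l2
    omega
  have h := hasSum_partialFraction hz (ξ := ξ) fun j h => by
    rw [e2] at h
    exact one_sub_qpow_ne_zero hz (mul_ne_zero two_ne_zero (hja j)) (by rw [h, sub_self])
  rw [tsum_theta3Exp, tsum_theta2Exp, e3] at h
  simp_rw [e1, e2] at h
  have hb : HasSum (fun j : ℤ => qpow z ((j + a : ℝ) : ℂ) / (1 - qpow z ((2 * (j + a) : ℝ) : ℂ)))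
      (oddLambert z a + -oddLambert z (1 - a)) := by
    -- For j = -(n + 1) the exponent j + a is -(n + 1 - a). The term is odd in the exponent, so the
    -- negative indices give minus the series at 1 - a.
    refine HasSum.of_nat_of_neg_add_one ?_ ?_
    · simpa using hasSum_oddLambert' hz h0
    · refine hasSum_of_eq (hasSum_oddLambert' hz (sub_pos.2 h1)).neg (fun n => ?_) rfl
      rw [← qpow_div_one_sub_neg]
      have e : (((-(n + 1 : ℤ) : ℤ) : ℝ) + a) = -(n + (1 - a)) := by
        push_cast
        ring
      rw [e]
  have hu := h.unique (hb.mul_right _)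
  have hC := heckeSum_eq hz
  rw [← mul_div_assoc, div_eq_iff hne]
  linear_combination
    (theta2 z (-(Real.pi / 2) + (2 * a - 1) * Real.pi * z)) * (-hC) + (-2 * I) * hu +
    (2 * qpow z (1 / 4) * theta2 z (-(Real.pi / 2) + (2 * a - 1) * Real.pi * z) * heckeSum z) * I_sq

/-! ### Derivative of the modular angle. -/

theorem hasDerivAt_arctanh {w : ℂ} (hw : ‖w‖ < 1) : HasDerivAt arctanh (1 / (1 - w ^ 2)) w := by
  have h1 := mem_slitPlane_of_norm_lt_one hw
  have h2 := mem_slitPlane_of_norm_lt_one (z := -w) (by rwa [norm_neg])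
  rw [← sub_eq_add_neg] at h2
  have d1 := ((hasDerivAt_id w).const_add 1).clog h1
  have d2 := ((hasDerivAt_id w).const_sub 1).clog h2
  have n1 := slitPlane_ne_zero h1
  have n2 := slitPlane_ne_zero h2
  have n3 : 1 - w ^ 2 ≠ 0 := by
    have : 1 - w ^ 2 = (1 + w) * (1 - w) := by ring
    rw [this]
    exact mul_ne_zero n1 n2
  refine ((d1.sub d2).div_const 2).congr_deriv ?_
  simp only [id]
  field_simp
  ring

theorem summable_qpow {z : ℂ} (hz : 0 < z.im) (u : ℝ) :
    Summable fun n : ℕ => qpow z ((n : ℂ) + u) := by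
  have h := (summable_geometric_of_norm_lt_one
    (norm_qpow_lt_one hz one_pos)).mul_left (qpow z (u : ℂ))
  refine h.congr fun n => ?_
  rw [← qpow_nat_mul, ← qpow_add]
  congr 1
  push_cast
  ring

theorem summable_arctanh {z : ℂ} (hz : 0 < z.im) (u : ℝ) :
    Summable fun n : ℕ => arctanh (qpow z ((n : ℂ) + u)) := by
  have h := summable_qpow hz u
  have h1 := Complex.summable_log_one_add_of_summable h
  have h2 := Complex.summable_log_one_add_of_summable h.neg
  refine ((h1.sub h2).div_const 2).congr fun n => ?_
  rw [arctanh, ← sub_eq_add_neg]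

/-- Termwise differentiation on u > a/2, where |q^{n+u}| ≤ r^n ρ with ρ < 1 keeps 1 - q^{2(n+u)}
away from 0 and dominates the derivatives geometrically. The differentiated series is the column
form of the Lambert series. -/
theorem hasDerivAt_modularAngle {z : ℂ} (hz : 0 < z.im) {a : ℝ} (h0 : 0 < a) :
    HasDerivAt (modularAngle z) (4 * Real.pi * I * z * oddLambert z a) a := by
  have hcast : ∀ (n : ℕ) (u : ℝ), ((n : ℂ) + u) = ((n + u : ℝ) : ℂ) := fun n u => by push_cast; rfl
  set ρ := ‖qpow z ((a / 2 : ℝ) : ℂ)‖ with hρ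
  have hρ1 : ρ < 1 := norm_qpow_lt_one hz (by positivity)
  set r := ‖qpow z ((1 : ℝ) : ℂ)‖ with hr
  have hr1 : r < 1 := norm_qpow_lt_one hz one_pos
  have hw : ∀ (n : ℕ) (u : ℝ), a / 2 < u → ‖qpow z ((n : ℂ) + u)‖ ≤ r ^ n * ρ := fun n u hu => by
    rw [hcast, hr, hρ, norm_qpow, norm_qpow, norm_qpow, ← Real.exp_nat_mul, ← Real.exp_add,
      Real.exp_le_exp]
    have := mul_pos (mul_pos two_pos Real.pi_pos) hz
    nlinarith
  have hw1 : ∀ (n : ℕ) (u : ℝ), a / 2 < u → ‖qpow z ((n : ℂ) + u)‖ ≤ ρ := fun n u hu =>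
    (hw n u hu).trans (mul_le_of_le_one_left (norm_nonneg _)
      (pow_le_one₀ (norm_nonneg _) hr1.le))
  have key := hasDerivAt_tsum_of_isPreconnected (𝕜 := ℝ) (F := ℂ)
    (g := fun (n : ℕ) (u : ℝ) => arctanh (qpow z ((n : ℂ) + u)))
    (g' := fun (n : ℕ) (u : ℝ) => 1 / (1 - qpow z ((n : ℂ) + u) ^ 2) *
      (qpow z ((n : ℂ) + u) * (2 * Real.pi * I * z)))
    (u := fun n => (1 - ρ)⁻¹ * (r ^ n * ‖(2 * Real.pi * I * z : ℂ)‖))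
    (t := Set.Ioi (a / 2)) (y₀ := a) (y := a)
    (((summable_geometric_of_lt_one (norm_nonneg _) hr1).mul_right _).mul_left _) isOpen_Ioi
    isPreconnected_Ioi
    (fun n u hu => by
      have d1 : HasDerivAt (fun u : ℝ => qpow z ((n : ℂ) + u))
          (qpow z ((n : ℂ) + u) * (2 * Real.pi * I * z)) u := by
        have := (((hasDerivAt_id u).ofReal_comp.const_add (n : ℂ)).const_mul
          (2 * Real.pi * I * z)).cexp
        simpa [qpow] using this
      exact (hasDerivAt_arctanh ((hw1 n u hu).trans_lt hρ1)).comp u d1)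
    (fun n u hu => by
      have l1 : 1 - ρ ≤ ‖1 - qpow z ((n : ℂ) + u) ^ 2‖ := by
        have b := norm_sub_norm_le (1 : ℂ) (qpow z ((n : ℂ) + u) ^ 2)
        rw [norm_one, norm_pow] at b
        have b1 := hw1 n u hu
        have b2 : ‖qpow z ((n : ℂ) + u)‖ ^ 2 ≤ ρ := by
          nlinarith [norm_nonneg (qpow z ((n : ℂ) + u))]
        linarith
      have l2 : ‖qpow z ((n : ℂ) + u)‖ ≤ r ^ n := (hw n u hu).trans
        (mul_le_of_le_one_right (pow_nonneg (norm_nonneg _) n) hρ1.le)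
      have : 0 < 1 - ρ := by linarith
      rw [norm_mul, norm_mul (qpow _ _), one_div, norm_inv]
      gcongr)
    (half_lt_self h0) (summable_arctanh hz a) (half_lt_self h0)
  have hL := ((hasSum_oddLambert' hz h0).mul_left (2 * Real.pi * I * z)).tsum_eq
  refine (key.const_mul (2 : ℂ)).congr_deriv ?_
  have e : ∀ n : ℕ, 1 / (1 - qpow z ((n : ℂ) + a) ^ 2) *
      (qpow z ((n : ℂ) + a) * (2 * Real.pi * I * z)) = 2 * Real.pi * I * z *
      (qpow z ((n + a : ℝ) : ℂ) / (1 - qpow z ((2 * (n + a) : ℝ) : ℂ))) := fun n => by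
    have : qpow z ((2 * (n + a) : ℝ) : ℂ) = qpow z ((n : ℂ) + a) ^ 2 := by
      rw [← qpow_nat_mul]
      congr 1
      push_cast
      ring
    rw [this, hcast]
    ring
  simp_rw [e]
  rw [hL]
  ring

/-! ### The series of cd₁ and ss at θ₀, and the remaining constants. -/

/-- The argument `v = π θ₀ / (2 K)`, for which `e ^ (2 i v) = -q ^ (2 a - 1)`. -/
noncomputable def shiftArg (z : ℂ) (a : ℝ) : ℂ := -(Real.pi / 2) + (2 * a - 1) * Real.pi * z

theorem neg_one_pow_eq_exp (n : ℕ) : (-1 : ℂ) ^ n = exp (n * (Real.pi * I)) := by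
  rw [exp_nat_mul, exp_pi_mul_I]

/-- Since e^{iv} = -i q^{a-1/2}, the power q^{n+1/2} and the sign (-1)^n are absorbed, leaving a
numerator of the Lambert series at a. The opposite exponential gives the one at 1 - a. -/
theorem qpow_mul_exp_shiftArg (z : ℂ) (a : ℝ) (n : ℕ) :
    (-1) ^ n * qpow z ((n : ℂ) + 1 / 2) * exp ((2 * n + 1) * shiftArg z a * I) =
      -I * qpow z (((2 * n + 1) * a : ℝ) : ℂ) := by
  have h : -I = exp (-(Real.pi / 2 * I)) := by rw [exp_neg, exp_pi_div_two_mul_I, inv_I]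
  rw [neg_one_pow_eq_exp, h, qpow, qpow, ← exp_add, ← exp_add, ← exp_add, shiftArg]
  congr 1
  push_cast
  ring

theorem qpow_mul_exp_neg_shiftArg (z : ℂ) (a : ℝ) (n : ℕ) :
    (-1) ^ n * qpow z ((n : ℂ) + 1 / 2) * exp (-((2 * n + 1) * shiftArg z a) * I) =
      I * qpow z (((2 * n + 1) * (1 - a) : ℝ) : ℂ) := by
  have h : I = exp (Real.pi / 2 * I) := exp_pi_div_two_mul_I.symm
  have h' : I * qpow z (((2 * n + 1) * (1 - a) : ℝ) : ℂ) =
      exp (Real.pi / 2 * I) * qpow z (((2 * n + 1) * (1 - a) : ℝ) : ℂ) := by rw [← h]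
  rw [h', neg_one_pow_eq_exp, qpow, qpow, ← exp_add, ← exp_add, ← exp_add, shiftArg]
  refine exp_eq_exp_of_int n ?_
  push_cast
  ring

/-- The series of `cd₁` as a combination of two Lambert series. -/
theorem hasSum_cos_shiftArg {z : ℂ} (hz : 0 < z.im) {a : ℝ} (h0 : 0 < a) (h1 : a < 1) :
    HasSum (fun n : ℕ => (-1) ^ n * qpow z ((n : ℂ) + 1 / 2) *
        cos ((2 * (n : ℂ) + 3) * shiftArg z a) / (1 - qpow z (2 * (n : ℂ) + 1)))
      ((-I * exp (2 * shiftArg z a * I) * oddLambert z a +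
        I * exp (-(2 * shiftArg z a) * I) * oddLambert z (1 - a)) / 2) := by
  have ha := (hasSum_oddLambert hz h0).mul_left (-I * exp (2 * shiftArg z a * I))
  have hb := (hasSum_oddLambert hz (sub_pos.2 h1)).mul_left (I * exp (-(2 * shiftArg z a) * I))
  refine hasSum_of_eq ((ha.add hb).div_const 2) (fun n => ?_) rfl
  have e1 : exp ((2 * (n : ℂ) + 3) * shiftArg z a * I) =
      exp (2 * shiftArg z a * I) * exp ((2 * n + 1) * shiftArg z a * I) := by
    rw [← exp_add]
    congr 1
    ring
  have e2 : exp (-((2 * (n : ℂ) + 3) * shiftArg z a) * I) =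
      exp (-(2 * shiftArg z a) * I) * exp (-((2 * n + 1) * shiftArg z a) * I) := by
    rw [← exp_add]
    congr 1
    ring
  have p := qpow_mul_exp_shiftArg z a n
  have m := qpow_mul_exp_neg_shiftArg z a n
  have e3 : qpow z ((2 * n + 1 : ℝ) : ℂ) = qpow z (2 * (n : ℂ) + 1) := by push_cast; rfl
  rw [cos, e1, e2, e3]
  linear_combination (exp (2 * shiftArg z a * I) * p + exp (-(2 * shiftArg z a) * I) * m) /
    2 / (1 - qpow z (2 * (n : ℂ) + 1))

/-- The series of `ss` as a combination of two Lambert series. -/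
theorem hasSum_sin_shiftArg {z : ℂ} (hz : 0 < z.im) {a : ℝ} (h0 : 0 < a) (h1 : a < 1) :
    HasSum (fun n : ℕ => qpow (z + 1 / 2) ((n : ℂ) + 1 / 2) *
        sin ((2 * (n : ℂ) + 1) * shiftArg z a) / (1 + qpow (z + 1 / 2) (2 * (n : ℂ) + 1)))
      (-I * (oddLambert z a + oddLambert z (1 - a)) / 2) := by
  have ha := (hasSum_oddLambert hz h0).mul_left (-I)
  have hb := (hasSum_oddLambert hz (sub_pos.2 h1)).mul_left (-I)
  refine hasSum_of_eq ((ha.add hb).div_const 2) (fun n => ?_) (by ring)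
  have p := qpow_mul_exp_shiftArg z a n
  have m := qpow_mul_exp_neg_shiftArg z a n
  have e3 : qpow z ((2 * n + 1 : ℝ) : ℂ) = qpow z (2 * (n : ℂ) + 1) := by push_cast; rfl
  -- Replacing q by -q supplies the sign (-1)^n and a factor i, and turns 1 + q^{2n+1} into 1 -
  -- q^{2n+1}, so the Lambert series are the same as for cd₁.
  have e4 : qpow (z + 1 / 2) ((n : ℂ) + 1 / 2) = I * ((-1) ^ n * qpow z ((n : ℂ) + 1 / 2)) := by
    have h : I * ((-1) ^ n * qpow z ((n : ℂ) + 1 / 2)) =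
        exp (Real.pi / 2 * I) * ((-1) ^ n * qpow z ((n : ℂ) + 1 / 2)) := by
      rw [exp_pi_div_two_mul_I]
    rw [h, neg_one_pow_eq_exp, qpow, qpow, ← exp_add, ← exp_add]
    congr 1
    ring
  have e5 : qpow (z + 1 / 2) (2 * (n : ℂ) + 1) = -qpow z (2 * (n : ℂ) + 1) := by
    rw [← neg_one_mul, ← exp_pi_mul_I, qpow, qpow, ← exp_add]
    refine exp_eq_exp_of_int n ?_
    push_cast
    ring
  rw [sin, e3, e4, e5, ← sub_eq_add_neg]
  linear_combination (I ^ 2 * (m - p)) / 2 / (1 - qpow z (2 * (n : ℂ) + 1)) +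
    (I * (qpow z (((2 * n + 1) * (1 - a) : ℝ) : ℂ) + qpow z (((2 * n + 1) * a : ℝ) : ℂ))) /
      2 / (1 - qpow z (2 * (n : ℂ) + 1)) * I_sq

/-- This explains the argument m'θ₀ of ss(-q, ·): the quarter period for -q is m'K, so the
normalized argument is again v. -/
theorem compModulus_mul_quarter {z : ℂ} (hz : 0 < z.im) :
    compModulus z * quarter z = quarter (z + 1 / 2) := by
  rw [compModulus_eq hz, quarter_eq hz, quarter_eq (by rwa [im_add_half])]
  have := theta3_ne_zero hz
  generalize theta3 (z + 1 / 2) 0 = t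
  field_simp

theorem quarter_ne_zero {z : ℂ} (hz : 0 < z.im) : quarter z ≠ 0 := by
  rw [quarter_eq hz]
  have := theta3_ne_zero hz
  have := Real.pi_ne_zero
  simp_all

theorem quarter'_ne_zero {z : ℂ} (hz : 0 < z.im) : quarter' z ≠ 0 := by
  rw [quarter'_eq hz]
  have := theta3_ne_zero hz
  have hz0 : z ≠ 0 := fun h => by simp [h] at hz
  have := Real.pi_ne_zero
  simp_all

theorem quarter_mul_modulus {z : ℂ} (hz : 0 < z.im) :
    quarter z * modulus z = Real.pi / 2 * theta2 z 0 ^ 2 := by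
  have := theta3_ne_zero hz
  rw [quarter_eq hz, modulus]
  field_simp

theorem modulus_mul_quarter' {z : ℂ} (hz : 0 < z.im) :
    modulus z * quarter' z = -I * Real.pi * z * theta2 z 0 ^ 2 := by
  have := theta3_ne_zero hz
  rw [quarter'_eq hz, modulus]
  field_simp

end ModularAngle

/-! ### Assembly of the evaluations. -/

theorem theorem21 :
    -- the functions `m'(q)`, `K`, `K'` of `q = e(z)` are well defined and nothing vanishes
    ModularAngle.IsContinuation ModularAngle.compModulusAxis ModularAngle.compModulus ∧
    ModularAngle.IsContinuation ModularAngle.quarterAxis ModularAngle.quarter ∧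
    ModularAngle.IsContinuation ModularAngle.quarterAxis' ModularAngle.quarter' ∧
    (∀ z : ℂ, 0 < z.im →
      ModularAngle.modulus z ≠ 0 ∧ ModularAngle.quarter z ≠ 0 ∧ ModularAngle.quarter' z ≠ 0) ∧
    ∀ (a x y : ℝ), 0 < a → a < 1 → x + 1 / 2 ∈ Set.Ioo (-(1 / 2) : ℝ) (1 / 2) → 0 < y →
    ∀ (z θ₀ θ₁ θ₂ : ℂ), z = (x : ℂ) + Complex.I * (y : ℂ) →
      θ₁ = -ModularAngle.quarter z + (4 * (a : ℂ) - 2) * (x : ℂ) * ModularAngle.quarter z →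
      θ₂ = (4 * (a : ℂ) - 2) * (y : ℂ) * ModularAngle.quarter z →
      θ₀ = θ₁ + Complex.I * θ₂ →
      -- the nome
      ModularAngle.qpow z (a : ℂ) = Complex.I * ModularAngle.qpow z (1 / 2) *
          Complex.exp (Complex.I * Real.pi * θ₀ / (2 * ModularAngle.quarter z)) ∧
      -- the series converge, `θ₀` is not a pole of `cd`, and the modular angle is differentiable
      Summable (ModularAngle.cd1Term z θ₀) ∧
      Summable (ModularAngle.ssTerm (z + 1 / 2) (ModularAngle.compModulus z * θ₀)) ∧
      ModularAngle.theta3 z (Real.pi * θ₀ / (2 * ModularAngle.quarter z)) ≠ 0 ∧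
      (∀ u : ℝ, 0 < u → Summable fun n : ℕ =>
        ModularAngle.arctanh (ModularAngle.qpow z ((n : ℂ) + (u : ℂ)))) ∧
      DifferentiableAt ℝ (ModularAngle.modularAngle z) a ∧
      -- the two evaluations
      ModularAngle.cd1 z θ₀ =
        Complex.exp (-Complex.I * Real.pi * θ₀ / ModularAngle.quarter z) * ModularAngle.cd z θ₀ -
          Complex.sin (Real.pi * θ₀ / ModularAngle.quarter z) /
            (ModularAngle.modulus z * ModularAngle.quarter' z) *
              deriv (ModularAngle.modularAngle z) a ∧
      ModularAngle.ss (z + 1 / 2) (ModularAngle.compModulus z * θ₀) =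
        1 / (ModularAngle.modulus z * ModularAngle.quarter' z) *
            deriv (ModularAngle.modularAngle z) a +
          Complex.I * ModularAngle.cd z θ₀ := by
  refine ⟨ModularAngle.isContinuation_continuation ModularAngle.isContinuation_theta4_div_theta3,
    ModularAngle.isContinuation_continuation ModularAngle.isContinuation_theta3_sq,
    ModularAngle.isContinuation_continuation ModularAngle.isContinuation_mul_theta3_sq,
    fun z hz => ⟨ModularAngle.modulus_ne_zero hz, ModularAngle.quarter_ne_zero hz,
      ModularAngle.quarter'_ne_zero hz⟩, ?_⟩
  intro a x y h0 h1 _ hy z θ₀ θ₁ θ₂ hzxy hθ₁ hθ₂ hθ₀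
  have hz : 0 < z.im := by simpa [hzxy] using hy
  have hK := ModularAngle.quarter_ne_zero hz
  have hz' : 0 < (z + 1 / 2).im := by rwa [ModularAngle.im_add_half]
  have hpi : (Real.pi : ℂ) ≠ 0 := Complex.ofReal_ne_zero.2 Real.pi_ne_zero
  have h2 := ModularAngle.theta2_ne_zero hz
  have h3 := ModularAngle.theta3_ne_zero hz
  have hz0 : z ≠ 0 := fun h => by simp [h] at hz
  have hθ : θ₀ = 2 * ModularAngle.quarter z / Real.pi * ModularAngle.shiftArg z a := by
    rw [hθ₀, hθ₁, hθ₂, ModularAngle.shiftArg, hzxy]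
    field_simp
    ring
  have hv : Real.pi * θ₀ / (2 * ModularAngle.quarter z) = ModularAngle.shiftArg z a := by
    rw [hθ]
    field_simp
  have hv' : Real.pi / (2 * ModularAngle.quarter z) * θ₀ = ModularAngle.shiftArg z a := by
    rw [← hv]
    ring
  have hv2 : Real.pi * θ₀ / ModularAngle.quarter z = 2 * ModularAngle.shiftArg z a := by
    rw [← hv]
    field_simp
  have hcomp : ModularAngle.compModulus z ≠ 0 := fun h => by
    have := ModularAngle.compModulus_mul_quarter hz
    rw [h, zero_mul] at this
    exact ModularAngle.quarter_ne_zero hz' this.symm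
  have hvs : Real.pi / (2 * ModularAngle.quarter (z + 1 / 2)) *
      (ModularAngle.compModulus z * θ₀) = ModularAngle.shiftArg z a := by
    rw [← hv', ← ModularAngle.compModulus_mul_quarter hz]
    field_simp
  have hcd1 : HasSum (ModularAngle.cd1Term z θ₀) _ :=
    ModularAngle.hasSum_of_eq (ModularAngle.hasSum_cos_shiftArg hz h0 h1)
      (fun n => by rw [ModularAngle.cd1Term, mul_assoc (2 * (n : ℂ) + 3), hv']) rfl
  have hss : HasSum (ModularAngle.ssTerm (z + 1 / 2) (ModularAngle.compModulus z * θ₀)) _ :=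
    ModularAngle.hasSum_of_eq (ModularAngle.hasSum_sin_shiftArg hz h0 h1)
      (fun n => by rw [ModularAngle.ssTerm, mul_assoc (2 * (n : ℂ) + 1), hvs]) rfl
  have hder := ModularAngle.hasDerivAt_modularAngle hz h0
  have hcd : ModularAngle.cd z θ₀ = -2 * Complex.I *
      (ModularAngle.oddLambert z a - ModularAngle.oddLambert z (1 - a)) /
        ModularAngle.theta2 z 0 ^ 2 := by
    rw [← ModularAngle.theta2_div_theta3_shift hz h0 h1, ModularAngle.cd, hv, ModularAngle.shiftArg]
    field_simp
  refine ⟨?_, hcd1.summable, hss.summable, ?_, fun u _ => ModularAngle.summable_arctanh hz u,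
    hder.differentiableAt, ?_, ?_⟩
  · have e : Complex.I * Real.pi * θ₀ / (2 * ModularAngle.quarter z) =
        ModularAngle.shiftArg z a * Complex.I := by
      rw [← hv]
      ring
    have h : Complex.I = Complex.exp (Real.pi / 2 * Complex.I) :=
      Complex.exp_pi_div_two_mul_I.symm
    have h' : ∀ w, Complex.I * w = Complex.exp (Real.pi / 2 * Complex.I) * w := fun w => by
      rw [← h]
    rw [e, mul_assoc, h', ModularAngle.qpow, ModularAngle.qpow, ← Complex.exp_add,
      ← Complex.exp_add, ModularAngle.shiftArg]
    congr 1
    ring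
  · rw [hv]
    exact ModularAngle.theta3_shift_ne_zero hz h0 h1
  · have e : -Complex.I * Real.pi * θ₀ / ModularAngle.quarter z =
        -(2 * ModularAngle.shiftArg z a) * Complex.I := by
      rw [← hv2]
      ring
    -- Over the common denominator ϑ₂(0)² and with E = e^{2iv}: cd₁ = 2i(E⁻¹L_{1-a} - E L_a), cd =
    -- -2i(L_a - L_{1-a}), θ'/(mK') = -4L_a. Expanding sin 2v in E leaves a linear identity in L_a
    -- and L_{1-a}.
    rw [ModularAngle.cd1, hcd1.tsum_eq, hder.deriv, hcd, e, hv2,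
      ModularAngle.quarter_mul_modulus hz, ModularAngle.modulus_mul_quarter' hz, Complex.sin]
    field_simp
    ring
  -- Here the prefactor of ss involves ϑ₂(-q)² = iϑ₂(q)², so ss = -2(L_a + L_{1-a})/ϑ₂².
  · rw [ModularAngle.ss, hss.tsum_eq, hder.deriv, hcd, ModularAngle.quarter_mul_modulus hz',
      ModularAngle.modulus_mul_quarter' hz, ModularAngle.theta2_add_half_sq]
    field_simp
    ring_nf
    simp only [Complex.I_sq]
    ring
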